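/- A \emph{generalized non-crossing tree} (GNC-tree) on $n+1$ points is a tree whose vertices are $n+1$ points on a circle, drawn with straight chords that do not cross, together with a labelling of the points by positive integers that is weakly increasing in counterclockwise order starting from the root (which is the first point, labelled $1$) and such that whenever $j$ is a label, every $i$ with $1\le i\le j$ is also a label. An edge from a vertex $v$ to its child $w$ is an \emph{ascent}, \emph{level} or \emph{descent}, encoded by the letter $u$, $h$ or $d$, according as the label of $v$ is less than, equal to or greater than the label of $w$; write $u(T),h(T),d(T)$ for the numbers of ascents, levels and descents of $T$. For a word $\sigma$ in the letters $u,h,d$, a GNC-tree is \emph{$\sigma$-avoiding} if no downward path (directed away from the root, starting at any vertex) is encoded by $\sigma$. Let $\mathsf{GNC}_n$ be the set of GNC-trees on $n+1$ points, $\mathsf{GNC}_n(\sigma)$ the subset of the $\sigma$-avoiding ones, and put $$T_{x,y,z}(t)=\sum_{n\ge0}t^n\sum_{T\in\mathsf{GNC}_n}x^{u(T)}y^{h(T)}z^{d(T)},\qquad T^{\sigma}_{x,y,z}(t)=\sum_{n\ge0}t^n\sum_{T\in\mathsf{GNC}_n(\sigma)}x^{u(T)}y^{h(T)}z^{d(T)}$$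 (with $0^0=1$), regarded as formal power series in $t$ over a commutative ring $R$ (for instance $R=\mathbb Z$) with $x,y,z\in R$. \textbf{Proposition.} The generating functions $T^{ud}=T^{ud}_{1,1,1}(t)$ and $T^{du}=T^{du}_{1,1,1}(t)$ of $ud$-avoiding and $du$-avoiding GNC-trees satisfy $$T^{ud}=1+2t\,(T^{ud})^2\bigl(1+t\,T_{0,1,0}(t)^2\,T^{du}\bigr),\qquad T^{du}=1+2t\,(T^{du})^2\,T^{ud},$$ and they are determined by these equations: if $A,B\in R[[t]]$ satisfy $A=1+2tA^2(1+tT_{0,1,0}(t)^2B)$ and $B=1+2tB^2A$, then $A=T^{ud}$ and $B=T^{du}$. -/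

import Mathlib

/-- The three kinds of edges of a labelled rooted tree, viewed from the root: an ascent `u`,
a level `h` and a descent `d`. -/
inductive GNCStep where
  | u
  | h
  | d
  deriving DecidableEq

/-- A rooted generalized non-crossing tree on `n + 1` points. The points are `0, 1, …, n` in
counterclockwise order on a circle, `0` being the first point labelled `1`, i.e. the root. -/
@[ext]
structure GNCTree (n : ℕ) where
  /-- the underlying graph -/
  graph : SimpleGraph (Fin (n + 1))
  /-- the label of each point -/
  label : Fin (n + 1) → ℕ
  isTree : graph.IsTree
  /-- no two chords cross -/
  noncrossing : ∀ a b c d : Fin (n + 1), a < b → b < c → c < d →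
    ¬ (graph.Adj a c ∧ graph.Adj b d)
  /-- the labels are weakly increasing in counterclockwise order -/
  label_mono : Monotone label
  /-- the labels are positive integers -/
  label_pos : ∀ v, 1 ≤ label v
  /-- if `j` is a label, then all `1 ≤ i ≤ j` are labels -/
  label_full : ∀ v, ∀ i, 1 ≤ i → i ≤ label v → ∃ w, label w = i

namespace GNCTree

theorem label_le {n : ℕ} (T : GNCTree n) (v : Fin (n + 1)) : T.label v ≤ n + 1 := by
  have hsub : Finset.Icc 1 (T.label v) ⊆ Finset.univ.image T.label := by
    intro i hi
    rw [Finset.mem_Icc] at hi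
    obtain ⟨w, hw⟩ := T.label_full v i hi.1 hi.2
    exact Finset.mem_image.mpr ⟨w, Finset.mem_univ _, hw⟩
  have h1 := Finset.card_le_card hsub
  have h2 : (Finset.univ.image T.label).card ≤ n + 1 := by
    simpa using Finset.card_image_le (s := Finset.univ) (f := T.label)
  simp only [Nat.card_Icc] at h1
  omega

instance finite (n : ℕ) : Finite (GNCTree n) := by
  let f : GNCTree n → SimpleGraph (Fin (n + 1)) × (Fin (n + 1) → Fin (n + 2)) :=
    fun T => (T.graph, fun v => ⟨T.label v, Nat.lt_succ_of_le (T.label_le v)⟩)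
  refine Finite.of_injective f ?_
  intro S T hST
  have h1 : S.graph = T.graph := congrArg Prod.fst hST
  have h2 : S.label = T.label := by
    funext v
    exact congrArg Fin.val (congrFun (congrArg Prod.snd hST) v)
  exact GNCTree.ext h1 h2

noncomputable instance fintype (n : ℕ) : Fintype (GNCTree n) := Fintype.ofFinite _

variable {n : ℕ}

/-- `T.IsEdge v w`: `{v, w}` is an edge of `T`, and `v` is on the path from the root to `w`
(so `v` is the parent of `w`). -/
def IsEdge (T : GNCTree n) (v w : Fin (n + 1)) : Prop :=
  T.graph.Adj v w ∧ ∃ p : T.graph.Walk 0 w, p.IsPath ∧ v ∈ p.support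

/-- The letter encoding an edge from `v` to `w`: `u` (ascent) if the label increases,
`h` (level) if it stays the same, `d` (descent) if it decreases. -/
def step (T : GNCTree n) (v w : Fin (n + 1)) : GNCStep :=
  if T.label v < T.label w then .u else if T.label v = T.label w then .h else .d

open Classical in
/-- The number of edges of `T` encoded by the letter `s`. -/
noncomputable def numSteps (T : GNCTree n) (s : GNCStep) : ℕ :=
  (Finset.univ.filter fun e : Fin (n + 1) × Fin (n + 1) =>
    T.IsEdge e.1 e.2 ∧ T.step e.1 e.2 = s).card

/-- Some path of `T` that starts at `v` and leads away from the root is encoded by the given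
word. -/
def Reads (T : GNCTree n) : Fin (n + 1) → List GNCStep → Prop
  | _, [] => True
  | v, s :: σ => ∃ w, T.IsEdge v w ∧ T.step v w = s ∧ T.Reads w σ

/-- `T` is `σ`-avoiding: no subpath of `T` (viewed from the root) is encoded by `σ`. -/
def Avoids (T : GNCTree n) (σ : List GNCStep) : Prop :=
  ∀ v, ¬ T.Reads v σ

end GNCTree

open Classical in
/-- The generating function `∑ₙ tⁿ ∑_T x^{u(T)} y^{h(T)} z^{d(T)}`, where `T` runs over the
generalized non-crossing trees on `n + 1` points that avoid every pattern in `P`, and `u(T)`,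
`h(T)`, `d(T)` are the numbers of ascents, levels and descents of `T`. -/
noncomputable def gncGenFun {R : Type*} [CommRing R] (P : Set (List GNCStep)) (x y z : R) :
    PowerSeries R :=
  PowerSeries.mk fun n =>
    ∑ T ∈ Finset.univ.filter (fun T : GNCTree n => ∀ σ ∈ P, T.Avoids σ),
      x ^ T.numSteps .u * y ^ T.numSteps .h * z ^ T.numSteps .d

/-- `T_{x,y,z}(t)`: the generating function of all generalized non-crossing trees. -/
noncomputable def gncT {R : Type*} [CommRing R] (x y z : R) : PowerSeries R :=
  gncGenFun ∅ x y z

/-- `T^σ_{x,y,z}(t)`: the generating function of the `σ`-avoiding trees. -/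
noncomputable def gncTAvoid {R : Type*} [CommRing R] (σ : List GNCStep) (x y z : R) :
    PowerSeries R :=
  gncGenFun {σ} x y z

/-! Cut a non-crossing tree at the last (largest) child `w` of its root. By planarity the
descendants of `w` fill a final segment of the points, so the tree splits uniquely into three
smaller ones: a tree `T` on the points before the segment, and the parts `L` and `R` of the branch
lying to the left and to the right of `w`, both rooted at `w`. To have its root first, `L` is read
in reverse order, which exchanges ascents and descents. The labels split likewise, with one free
bit: whether the label rises between `T` and `L`. This bit gives the factor 2.

The root edge to `w` is never a descent, so a tree avoids `du` iff `T` and `R` avoid `du` and the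
reflected `L` avoids `ud`; this is the second equation. For `ud`, the root edge followed by a
descent into `L` must also be excluded, so the reflected `L` must avoid `du` and have no ascent at
its root. Cutting such an `L` once more, everything up to its last root child carries the same
label, and the remaining part avoids `du`; hence the series `1 + t * F ^ 2 * B`, with `F` counting
constant labellings and `B` the `du`-avoiding trees.

The combinatorial core is `exists_glue`, `glueEdges_injective`, `hasAscentDescent_glue` and
`hasDescentAscent_glue`; `genFun_eq` turns the decomposition into series and `card_filter_eq`
transfers the counts to GNC-trees. Uniqueness holds because the system is contracting for the
`X`-adic topology. -/

open Relation SimpleGraph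

/-! ### Trees and labellings on integer intervals, and gluing three of them -/

/-- `D` is the parent-child relation of a non-crossing tree on the points `0, …, n` with
root `0`. -/
structure IsNCArborescence (n : ℤ) (D : ℤ → ℤ → Prop) : Prop where
  supp : ∀ {x y}, D x y → 0 ≤ x ∧ x ≤ n ∧ 0 < y ∧ y ≤ n
  reach : ∀ {x}, 0 ≤ x → x ≤ n → ReflTransGen D 0 x
  parent : ∀ {x y z}, D x z → D y z → x = y
  noncrossing : ∀ {a b c d}, a < b → b < c → c < d → D a c ∨ D c a → D b d ∨ D d b → False

/-- `f` starts at `0` and increases by `0` or `1` in each step on `0, …, n`. -/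
structure IsSlowLabelling (n : ℤ) (f : ℤ → ℤ) : Prop where
  zero : f 0 = 0
  step : ∀ {x}, 0 ≤ x → x < n → f (x + 1) = f x ∨ f (x + 1) = f x + 1

theorem IsSlowLabelling.mono {n : ℤ} {f : ℤ → ℤ} (hf : IsSlowLabelling n f) {x y : ℤ}
    (hx : 0 ≤ x) (hxy : x ≤ y) (hy : y ≤ n) : f x ≤ f y := by
  induction y, hxy using Int.leInduction with
  | base => exact le_rfl
  | succ m hm ih =>
    have h1 := ih (by omega)
    rcases hf.step (x := m) (by omega) (by omega) with h | h <;> omega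

theorem IsSlowLabelling.nonneg {n : ℤ} {f : ℤ → ℤ} (hf : IsSlowLabelling n f) {x : ℤ}
    (hx : 0 ≤ x) (hn : x ≤ n) : 0 ≤ f x := by
  have := hf.mono le_rfl hx hn
  rwa [hf.zero] at this

/-- The tree whose last root edge leads to `w = i + j + 1`, with a tree on `0, …, i` before it,
a reflected tree on `i + 1, …, w` to the left of `w`, and a tree on `w, w + 1, …` to the right
of `w`. -/
def glueEdges (i j : ℤ) (D₁ D₂ D₃ : ℤ → ℤ → Prop) (x y : ℤ) : Prop :=
  D₁ x y ∨ (x = 0 ∧ y = i + j + 1) ∨ D₂ (i + j + 1 - x) (i + j + 1 - y) ∨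
    D₃ (x - (i + j + 1)) (y - (i + j + 1))

/-- The labelling of the points of `glueEdges`, where `b` is the increase between `i` and
`i + 1`. -/
def glueLabels (i j b : ℤ) (f₁ f₂ f₃ : ℤ → ℤ) (x : ℤ) : ℤ :=
  if x ≤ i then f₁ x
  -- Reflection reverses the order, so `f₂` is subtracted; the label is `f₁ i + b` at `i + 1` and
  -- `f₁ i + b + f₂ j` at `w`.
  else if x ≤ i + j + 1 then f₁ i + b + f₂ j - f₂ (i + j + 1 - x)
  else f₁ i + b + f₂ j + f₃ (x - (i + j + 1))

section Glue

variable {i j k b : ℤ} {D₁ D₂ D₃ : ℤ → ℤ → Prop} {f₁ f₂ f₃ : ℤ → ℤ}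

theorem glueLabels_left {x : ℤ} (hx : x ≤ i) : glueLabels i j b f₁ f₂ f₃ x = f₁ x := by
  simp [glueLabels, hx]

theorem glueLabels_middle {x : ℤ} (hx : i < x) (hx' : x ≤ i + j + 1) :
    glueLabels i j b f₁ f₂ f₃ x = f₁ i + b + f₂ j - f₂ (i + j + 1 - x) := by
  simp [glueLabels, not_le.mpr hx, hx']

/-- At the shared point `i + j + 1` the middle and right formulas agree because `f₂` and `f₃` vanish
at `0`, so the range may include that point. -/
theorem glueLabels_right (hj : 0 ≤ j) (h₂ : f₂ 0 = 0) (h₃ : f₃ 0 = 0) {x : ℤ}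
    (hx : i + j + 1 ≤ x) :
    glueLabels i j b f₁ f₂ f₃ x = f₁ i + b + f₂ j + f₃ (x - (i + j + 1)) := by
  rcases hx.eq_or_lt with rfl | hx
  · rw [glueLabels_middle (by omega) le_rfl]; simp [h₂, h₃]
  · simp [glueLabels, not_le.mpr hx, show ¬ x ≤ i by omega]

theorem IsNCArborescence.glue (hi : 0 ≤ i) (hj : 0 ≤ j) (hk : 0 ≤ k)
    (h₁ : IsNCArborescence i D₁) (h₂ : IsNCArborescence j D₂) (h₃ : IsNCArborescence k D₃) :
    IsNCArborescence (i + j + k + 1) (glueEdges i j D₁ D₂ D₃) where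
  supp := by
    rintro x y (h | ⟨rfl, rfl⟩ | h | h)
    · have := h₁.supp h; omega
    · omega
    · have := h₂.supp h; omega
    · have := h₃.supp h; omega
  reach := by
    intro x hx hx'
    have hw : ReflTransGen (glueEdges i j D₁ D₂ D₃) 0 (i + j + 1) :=
      .single (.inr (.inl ⟨rfl, rfl⟩))
    rcases le_or_gt x i with hxi | hxi
    · exact ReflTransGen.mono (fun _ _ h => Or.inl h) _ _ (h₁.reach hx hxi)
    rcases le_or_gt x (i + j + 1) with hxj | hxj
    · refine hw.trans ?_
      have := ReflTransGen.lift (p := glueEdges i j D₁ D₂ D₃) (fun u => i + j + 1 - u)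
        (fun a c h => .inr (.inr (.inl (by simpa using h))))
        _ _ (h₂.reach (x := i + j + 1 - x) (by omega) (by omega))
      simpa [Function.onFun] using this
    · refine hw.trans ?_
      have := ReflTransGen.lift (p := glueEdges i j D₁ D₂ D₃) (fun u => u + (i + j + 1))
        (fun a c h => .inr (.inr (.inr (by simpa using h))))
        _ _ (h₃.reach (x := x - (i + j + 1)) (by omega) (by omega))
      simpa [Function.onFun] using this
  parent := by
    rintro x y z (h | ⟨h, h'⟩ | h | h) (g | ⟨g, g'⟩ | g | g)
    case inl.inl => exact h₁.parent h g
    case inr.inr.inl.inr.inr.inl => have := h₂.parent h g; omega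
    case inr.inr.inr.inr.inr.inr => have := h₃.parent h g; omega
    all_goals
      first | have := h₁.supp h | have := h₂.supp h | have := h₃.supp h | skip
      first | have := h₁.supp g | have := h₂.supp g | have := h₃.supp g | skip
      omega
  noncrossing := by
    -- Every chord other than the one from `0` to `i + j + 1` lies in one of three intervals that
    -- overlap at most in an endpoint, so two crossing chords belong to the same part.
    have key : ∀ {p q : ℤ}, p < q →
        glueEdges i j D₁ D₂ D₃ p q ∨ glueEdges i j D₁ D₂ D₃ q p →
        ((0 ≤ p ∧ q ≤ i) ∧ (D₁ p q ∨ D₁ q p)) ∨ (p = 0 ∧ q = i + j + 1) ∨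
        ((i + 1 ≤ p ∧ q ≤ i + j + 1) ∧ (D₂ (i + j + 1 - p) (i + j + 1 - q) ∨
          D₂ (i + j + 1 - q) (i + j + 1 - p))) ∨
        ((i + j + 1 ≤ p ∧ q ≤ i + j + k + 1) ∧ (D₃ (p - (i + j + 1)) (q - (i + j + 1)) ∨
          D₃ (q - (i + j + 1)) (p - (i + j + 1)))) := by
      rintro p q hpq ((h | h | h | h) | (h | h | h | h))
      · have := h₁.supp h; exact .inl ⟨by omega, .inl h⟩
      · exact .inr (.inl h)
      · have := h₂.supp h; exact .inr (.inr (.inl ⟨by omega, .inl h⟩))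
      · have := h₃.supp h; exact .inr (.inr (.inr ⟨by omega, .inl h⟩))
      · have := h₁.supp h; exact .inl ⟨by omega, .inr h⟩
      · omega
      · have := h₂.supp h; exact .inr (.inr (.inl ⟨by omega, .inr h⟩))
      · have := h₃.supp h; exact .inr (.inr (.inr ⟨by omega, .inr h⟩))
    intro p q r s hpq hqr hrs h g
    rcases key (by omega) h with ⟨h', h⟩ | h | ⟨h', h⟩ | ⟨h', h⟩ <;>
    rcases key (by omega) g with ⟨g', g⟩ | g | ⟨g', g⟩ | ⟨g', g⟩
    case inl.inl => exact h₁.noncrossing hpq hqr hrs h g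
    -- Reflection reverses the four points, so the two chords exchange roles.
    case inr.inr.inl.inr.inr.inl =>
      exact h₂.noncrossing (by omega) (by omega) (by omega) g.symm h.symm
    case inr.inr.inr.inr.inr.inr =>
      exact h₃.noncrossing (by omega) (by omega) (by omega) h g
    all_goals omega

theorem IsSlowLabelling.glue (hi : 0 ≤ i) (hj : 0 ≤ j) (hb : b = 0 ∨ b = 1)
    (h₁ : IsSlowLabelling i f₁) (h₂ : IsSlowLabelling j f₂) (h₃ : IsSlowLabelling k f₃) :
    IsSlowLabelling (i + j + k + 1) (glueLabels i j b f₁ f₂ f₃) where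
  zero := by rw [glueLabels_left hi, h₁.zero]
  step := by
    intro x hx hx'
    rcases lt_trichotomy x i with hxi | rfl | hxi
    · rw [glueLabels_left (x := x + 1) (by omega), glueLabels_left (by omega)]
      exact h₁.step hx hxi
    · rw [glueLabels_left le_rfl, glueLabels_middle (by omega) (by omega)]
      rw [show x + j + 1 - (x + 1) = j by ring]
      omega
    rcases lt_or_ge x (i + j + 1) with hxj | hxj
    · rw [glueLabels_middle (x := x + 1) (by omega) (by omega),
        glueLabels_middle (by omega) (by omega)]
      have := h₂.step (x := i + j + 1 - (x + 1)) (by omega) (by omega)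
      rw [show i + j + 1 - (x + 1) + 1 = i + j + 1 - x by ring] at this
      omega
    · rw [glueLabels_right (x := x + 1) hj h₂.zero h₃.zero (by omega),
        glueLabels_right hj h₂.zero h₃.zero hxj]
      have := h₃.step (x := x - (i + j + 1)) (by omega) (by omega)
      rw [show x - (i + j + 1) + 1 = x + 1 - (i + j + 1) by ring] at this
      omega

end Glue

/-! ### Cutting a tree at the last child of the root -/

/-- `P` is inherited backwards along edges, so knowing it at the endpoint keeps the whole path
inside the part being cut out. -/
theorem Relation.ReflTransGen.lift_of_closed {α β : Type*} {D : α → α → Prop}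
    {D' : β → β → Prop} (g : α → β) (P : α → Prop) {a x : α}
    (h : ∀ y z, ReflTransGen D a y → D y z → P z → P y ∧ D' (g y) (g z))
    (hx : ReflTransGen D a x) (hP : P x) : ReflTransGen D' (g a) (g x) := by
  induction hx with
  | refl => exact .refl
  | tail hy hyz ih =>
    obtain ⟨h1, h2⟩ := h _ _ hy hyz hP
    exact (ih h1).tail h2

/-- A discrete intermediate value principle: it supplies the edge at which a path crosses a given
chord. -/
theorem Relation.ReflTransGen.exists_step {α : Type*} {D : α → α → Prop} {P : α → Prop}
    {a x : α} (hx : ReflTransGen D a x) (ha : P a) (hPx : ¬ P x) :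
    ∃ y z, ReflTransGen D a y ∧ D y z ∧ ReflTransGen D z x ∧ P y ∧ ¬ P z := by
  induction hx with
  | refl => exact absurd ha hPx
  | @tail y z hy hyz ih =>
    by_cases hPy : P y
    · exact ⟨y, z, hy, hyz, .refl, hPy, hPx⟩
    · obtain ⟨u, v, h1, h2, h3, h4, h5⟩ := ih hPy
      exact ⟨u, v, h1, h2, h3.tail hyz, h4, h5⟩

namespace IsNCArborescence

/-- The descendants of the largest child of the root form a final segment. -/
theorem exists_descendants_eq {n : ℤ} {D : ℤ → ℤ → Prop} (h : IsNCArborescence n D) {w : ℤ}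
    (hw : D 0 w) (hmax : ∀ y, D 0 y → y ≤ w) :
    ∃ m, 0 < m ∧ m ≤ w ∧ ∀ x, ReflTransGen D w x ↔ m ≤ x ∧ x ≤ n := by
  have hw' := h.supp hw
  have hle : ∀ {x}, ReflTransGen D w x → 0 < x ∧ x ≤ n := by
    intro x hx
    rcases hx.cases_tail with rfl | ⟨y, -, hy⟩
    · omega
    · have := h.supp hy; omega
  obtain ⟨m, hm, hmin⟩ := Int.exists_least_of_bdd (P := fun x => ReflTransGen D w x)
    ⟨0, fun z hz => (hle hz).1.le⟩ ⟨w, .refl⟩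
  refine ⟨m, (hle hm).1, hmin w .refl, fun x => ⟨fun hx => ⟨hmin x hx, (hle hx).2⟩, ?_⟩⟩
  rintro ⟨hmx, hxn⟩
  by_contra hx
  have hm0 := (hle hm).1
  have hmw := hmin w .refl
  have h0x := h.reach (x := x) (by omega) hxn
  -- Ancestors of `x` are not descendants of `w`, so the path to `x` and the path from `w` to `m`
  -- share no vertex.
  have hnd : ∀ {z}, ReflTransGen D z x → ¬ ReflTransGen D w z := fun h1 h2 => hx (h2.trans h1)
  have hxw : x ≠ w := fun hh => hx (hh ▸ .refl)
  have hxm : x ≠ m := fun hh => hx (hh ▸ hm)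
  rcases lt_or_gt_of_ne hxw with hlt | hgt
  -- The path to `x` enters the interval from `m` to `w` by an edge `p → q`. The chord `pq`
  -- separates `w` from `m`, so some edge on the path from `w` to `m` crosses it.
  · obtain ⟨p, q, -, hpq, hqx, hp, hq⟩ := h0x.exists_step (P := fun z => z < m ∨ w < z)
      (by omega) (by omega)
    have hpx : ReflTransGen D p x := hqx.head hpq
    have hqm : q ≠ m := fun hh => hnd hqx (hh ▸ hm)
    have hqw : q ≠ w := fun hh => hnd hqx (hh ▸ .refl)
    rcases hp with hp | hp
    · obtain ⟨y, z, hy, hyz, -, hy1, hz1⟩ := hm.exists_step (P := fun z => z < p ∨ q < z)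
        (by omega) (by omega)
      have hz := hy.tail hyz
      have a1 : y ≠ p := fun hh => hnd hpx (hh ▸ hy)
      have a2 : y ≠ q := fun hh => hnd hqx (hh ▸ hy)
      have a3 : z ≠ p := fun hh => hnd hpx (hh ▸ hz)
      have a4 : z ≠ q := fun hh => hnd hqx (hh ▸ hz)
      rcases hy1 with hy1 | hy1
      · exact h.noncrossing hy1 (by omega) (by omega) (.inl hyz) (.inl hpq)
      · exact h.noncrossing (b := z) (by omega) (by omega) hy1 (.inl hpq) (.inr hyz)
    · obtain ⟨y, z, hy, hyz, -, hy1, hz1⟩ := hm.exists_step (P := fun z => q < z ∧ z < p)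
        (by omega) (by omega)
      have hz := hy.tail hyz
      have a3 : z ≠ p := fun hh => hnd hpx (hh ▸ hz)
      have a4 : z ≠ q := fun hh => hnd hqx (hh ▸ hz)
      rcases lt_or_ge z q with hz1 | hz1
      · exact h.noncrossing hz1 hy1.1 hy1.2 (.inr hyz) (.inr hpq)
      · exact h.noncrossing hy1.1 hy1.2 (by omega) (.inr hpq) (.inl hyz)
  -- The path to `x` jumps over `w` by an edge `p → q`. Maximality of `w` excludes `p = 0`, so this
  -- edge crosses the chord from `0` to `w`.
  · obtain ⟨p, q, -, hpq, hqx, hp, hq⟩ := h0x.exists_step (P := fun z => z ≤ w)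
      (by omega) (by omega)
    have hpw : p ≠ w := fun hh => hx (hh ▸ hqx.head hpq)
    have hp0 : p ≠ 0 := fun hh => hq (hmax q (hh ▸ hpq))
    have := h.supp hpq
    exact h.noncrossing (a := 0) (b := p) (c := w) (d := q) (by omega) (by omega) (by omega)
      (.inl hw) (.inl hpq)

theorem exists_glue {n : ℤ} {D : ℤ → ℤ → Prop} (h : IsNCArborescence n D) (hn : 0 < n) :
    ∃ i j k D₁ D₂ D₃, 0 ≤ i ∧ 0 ≤ j ∧ 0 ≤ k ∧ n = i + j + k + 1 ∧ IsNCArborescence i D₁ ∧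
      IsNCArborescence j D₂ ∧ IsNCArborescence k D₃ ∧ D = glueEdges i j D₁ D₂ D₃ := by
  obtain ⟨w, hw, hmax⟩ := Int.exists_greatest_of_bdd (P := fun x => D 0 x)
    ⟨n, fun z hz => (h.supp hz).2.2.2⟩ (by
      rcases (h.reach hn.le le_rfl).cases_head with h0 | ⟨c, hc, -⟩
      · omega
      · exact ⟨c, hc⟩)
  obtain ⟨m, hm0, hmw, hdesc⟩ := h.exists_descendants_eq hw hmax
  have hw' := h.supp hw
  -- Edges never leave the segment starting at `m` and enter it only at `w`; the chord from `0` to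
  -- `w` keeps the points on its two sides apart. The facts `e1` to `e7` record this.
  have e1 : ∀ {x y}, D x y → m ≤ x → m ≤ y := fun {x y} hxy hx => by
    have := h.supp hxy
    exact ((hdesc y).1 (((hdesc x).2 ⟨hx, by omega⟩).tail hxy)).1
  have e2 : ∀ {x y}, D x y → m ≤ y → y ≠ w → m ≤ x := fun {x y} hxy hy hyw => by
    have := h.supp hxy
    rcases ((hdesc y).2 ⟨hy, by omega⟩).cases_tail with h1 | ⟨z, hz, hzy⟩
    · exact absurd h1 hyw
    · rw [h.parent hxy hzy]; exact ((hdesc z).1 hz).1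
  have e3 : ∀ {x}, D x w → x = 0 := fun hx => h.parent hx hw
  have e4 : ∀ {x y}, D x y → 0 < x → x < w → y ≤ w := fun {x y} hxy h0 h1 => by
    by_contra hy
    exact h.noncrossing h0 h1 (not_le.1 hy) (.inl hw) (.inl hxy)
  have e5 : ∀ {x y}, D x y → 0 < y → y < w → x ≤ w := fun {x y} hxy h0 h1 => by
    by_contra hy
    exact h.noncrossing h0 h1 (not_le.1 hy) (.inl hw) (.inr hxy)
  have e6 : ∀ {x y}, D x y → m ≤ y → y < w → x ≤ w ∧ m ≤ x := fun {x y} hxy h0 h1 =>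
    ⟨e5 hxy (by omega) h1, e2 hxy h0 (by omega)⟩
  have e7 : ∀ {x y}, D x y → w < y → w ≤ x := fun {x y} hxy h0 => by
    by_contra hx
    have := e4 hxy (by have := e2 hxy (by omega) (by omega); omega) (by omega)
    omega
  refine ⟨m - 1, w - m, n - w, fun x y => D x y ∧ y < m,
    fun x y => D (w - x) (w - y) ∧ m ≤ w - y ∧ w - y < w, fun x y => D (x + w) (y + w) ∧ 0 < y,
    by omega, by omega, by omega, by omega, ⟨?_, ?_, ?_, ?_⟩, ⟨?_, ?_, ?_, ?_⟩, ⟨?_, ?_, ?_, ?_⟩, ?_⟩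
  · rintro x y ⟨hxy, hy⟩
    have := h.supp hxy
    have : ¬ m ≤ x := fun hx => by have := e1 hxy hx; omega
    omega
  · intro x hx hx'
    refine (h.reach hx (by omega)).lift_of_closed id (fun z => z < m) ?_ (by omega)
    intro y z _ hyz hz
    exact ⟨lt_of_not_ge fun hy => by have := e1 hyz hy; omega, hyz, hz⟩
  · exact fun hx hy => h.parent hx.1 hy.1
  · exact fun h1 h2 h3 h4 h5 => h.noncrossing h1 h2 h3 (h4.imp And.left And.left)
      (h5.imp And.left And.left)
  · rintro x y ⟨hxy, hy⟩
    have := e6 hxy hy.1 hy.2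
    omega
  · intro x hx hx'
    have := ((hdesc (w - x)).2 ⟨by omega, by omega⟩).lift_of_closed
      (D' := fun x y => D (w - x) (w - y) ∧ m ≤ w - y ∧ w - y < w) (fun z => w - z)
      (fun z => m ≤ z ∧ z ≤ w) ?_ (by omega)
    · simpa using this
    intro y z hy hyz hz
    have hym := (hdesc y).1 hy
    have hzw : z ≠ w := by
      rintro rfl
      have := e3 hyz
      omega
    have := e6 hyz hz.1 (by omega)
    simp only [sub_sub_cancel]
    exact ⟨by omega, hyz, by omega⟩
  · intro x y z hx hy
    have := h.parent hx.1 hy.1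
    omega
  · intro a b c d h1 h2 h3 h4 h5
    exact h.noncrossing (a := w - d) (b := w - c) (c := w - b) (d := w - a)
      (by omega) (by omega) (by omega) (h5.symm.imp And.left And.left)
      (h4.symm.imp And.left And.left)
  · rintro x y ⟨hxy, hy⟩
    have := h.supp hxy
    have := e7 hxy (by omega)
    omega
  · intro x hx hx'
    have := ((hdesc (x + w)).2 ⟨by omega, by omega⟩).lift_of_closed
      (D' := fun x y => D (x + w) (y + w) ∧ 0 < y) (fun z => z - w)
      (fun z => w ≤ z) ?_ (by omega)
    · simpa using this
    intro y z hy hyz hz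
    have hym := (hdesc y).1 hy
    have hzw : z ≠ w := by
      rintro rfl
      have := e3 hyz
      omega
    have := e7 hyz (by omega)
    simp only [sub_add_cancel]
    exact ⟨by omega, hyz, by omega⟩
  · intro x y z hx hy
    have := h.parent hx.1 hy.1
    omega
  · intro a b c d h1 h2 h3 h4 h5
    exact h.noncrossing (a := a + w) (b := b + w) (c := c + w) (d := d + w)
      (by omega) (by omega) (by omega) (h4.imp And.left And.left)
      (h5.imp And.left And.left)
  · ext x y
    simp only [glueEdges, show m - 1 + (w - m) + 1 = w by ring, sub_sub_cancel, sub_add_cancel]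
    constructor
    · intro hxy
      rcases lt_or_ge y m with h1 | h1
      · exact .inl ⟨hxy, h1⟩
      rcases lt_trichotomy y w with h2 | rfl | h2
      · exact .inr (.inr (.inl ⟨hxy, h1, h2⟩))
      · exact .inr (.inl ⟨e3 hxy, rfl⟩)
      · exact .inr (.inr (.inr ⟨hxy, by omega⟩))
    · rintro (h | ⟨rfl, rfl⟩ | h | h)
      exacts [h.1, hw, h.1, h.1]

end IsNCArborescence

theorem IsSlowLabelling.exists_glue {i j k : ℤ} {f : ℤ → ℤ} (hi : 0 ≤ i) (hj : 0 ≤ j)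
    (hk : 0 ≤ k) (h : IsSlowLabelling (i + j + k + 1) f) :
    ∃ b f₁ f₂ f₃, (b = 0 ∨ b = 1) ∧ IsSlowLabelling i f₁ ∧ IsSlowLabelling j f₂ ∧
      IsSlowLabelling k f₃ ∧ f = glueLabels i j b f₁ f₂ f₃ := by
  -- `f` itself serves as `f₁`, since only its values up to `i` matter; the other two labellings
  -- measure distances from the label of the cut point.
  refine ⟨f (i + 1) - f i, f, fun x => f (i + j + 1) - f (i + j + 1 - x),
    fun x => f (x + (i + j + 1)) - f (i + j + 1), ?_, ⟨h.zero, fun hx hx' => ?_⟩,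
    ⟨by simp, fun {x} hx hx' => ?_⟩, ⟨by simp, fun {x} hx hx' => ?_⟩, ?_⟩
  · have := h.step (x := i) hi (by omega); omega
  · exact h.step hx (by omega)
  · have := h.step (x := i + j + 1 - (x + 1)) (by omega) (by omega)
    rw [show i + j + 1 - (x + 1) + 1 = i + j + 1 - x by ring] at this
    omega
  · have := h.step (x := x + (i + j + 1)) (by omega) (by omega)
    rw [show x + (i + j + 1) + 1 = x + 1 + (i + j + 1) by ring] at this
    omega
  · funext x
    simp only [glueLabels, sub_sub_cancel, sub_add_cancel, show i + j + 1 - j = i + 1 by ring]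
    split_ifs <;> ring

/-! ### Uniqueness of the decomposition -/

section Injective

variable {i j k i' j' k' : ℤ} {D₁ D₂ D₃ D₁' D₂' D₃' : ℤ → ℤ → Prop}

theorem glueEdges_zero (hi : 0 ≤ i) (hj : 0 ≤ j)
    (h₂ : IsNCArborescence j D₂) (h₃ : IsNCArborescence k D₃)
    {y : ℤ} : glueEdges i j D₁ D₂ D₃ 0 y ↔ D₁ 0 y ∨ y = i + j + 1 := by
  constructor
  · rintro (h | h | h | h)
    · exact .inl h
    · exact .inr h.2
    · have := h₂.supp h; omega
    · have := h₃.supp h; omega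
  · rintro (h | h)
    · exact .inl h
    · exact .inr (.inl ⟨rfl, h⟩)

/-- With `glueEdges_reach_succ`, this identifies `i + 1` as the least descendant of the last root
child, which recovers `i` from the glued tree. -/
theorem glueEdges_descendant (hj : 0 ≤ j)
    (h₁ : IsNCArborescence i D₁) (h₂ : IsNCArborescence j D₂) (h₃ : IsNCArborescence k D₃)
    {x : ℤ} (hx : ReflTransGen (glueEdges i j D₁ D₂ D₃) (i + j + 1) x) : i < x := by
  induction hx with
  | refl => omega
  | tail _ hyz ih =>
    rcases hyz with h | h | h | h
    · have := h₁.supp h; omega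
    · omega
    · have := h₂.supp h; omega
    · have := h₃.supp h; omega

theorem glueEdges_reach_succ (hj : 0 ≤ j) (h₂ : IsNCArborescence j D₂) :
    ReflTransGen (glueEdges i j D₁ D₂ D₃) (i + j + 1) (i + 1) := by
  have := ReflTransGen.lift (p := glueEdges i j D₁ D₂ D₃) (fun u => i + j + 1 - u)
    (fun a c h => .inr (.inr (.inl (by simpa using h)))) _ _ (h₂.reach hj le_rfl)
  simpa [Function.onFun, show i + j + 1 - j = i + 1 by ring] using this

/-- The position of the child endpoint alone tells which part an edge belongs to, so each part is
recovered by restricting the child. The next two lemmas do the same. -/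
theorem glueEdges_left_iff (hj : 0 ≤ j) (h₁ : IsNCArborescence i D₁)
    (h₂ : IsNCArborescence j D₂) (h₃ : IsNCArborescence k D₃) {x y : ℤ} :
    D₁ x y ↔ glueEdges i j D₁ D₂ D₃ x y ∧ y ≤ i := by
  constructor
  · exact fun h => ⟨.inl h, (h₁.supp h).2.2.2⟩
  · rintro ⟨h | h | h | h, hy⟩
    · exact h
    · omega
    · have := h₂.supp h; omega
    · have := h₃.supp h; omega

theorem glueEdges_middle_iff (h₁ : IsNCArborescence i D₁)
    (h₂ : IsNCArborescence j D₂) (h₃ : IsNCArborescence k D₃) {x y : ℤ} :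
    D₂ x y ↔ glueEdges i j D₁ D₂ D₃ (i + j + 1 - x) (i + j + 1 - y) ∧ 0 < y ∧ y ≤ j := by
  constructor
  · exact fun h => ⟨.inr (.inr (.inl (by simpa using h))), (h₂.supp h).2.2⟩
  · rintro ⟨h | h | h | h, hy⟩
    · have := h₁.supp h; omega
    · omega
    · simpa using h
    · have := h₃.supp h; omega

theorem glueEdges_right_iff (hj : 0 ≤ j) (h₁ : IsNCArborescence i D₁)
    (h₂ : IsNCArborescence j D₂) (h₃ : IsNCArborescence k D₃) {x y : ℤ} :
    D₃ x y ↔ glueEdges i j D₁ D₂ D₃ (x + (i + j + 1)) (y + (i + j + 1)) ∧ 0 < y := by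
  constructor
  · exact fun h => ⟨.inr (.inr (.inr (by simpa using h))), (h₃.supp h).2.2.1⟩
  · rintro ⟨h | h | h | h, hy⟩
    · have := h₁.supp h; omega
    · omega
    · have := h₂.supp h; omega
    · simpa using h

/-- The sum `i + j` is read off from the largest child of the root and `i` from the least descendant
of that child; the three parts are then restrictions. -/
theorem glueEdges_injective (hi : 0 ≤ i) (hj : 0 ≤ j)
    (h₁ : IsNCArborescence i D₁) (h₂ : IsNCArborescence j D₂) (h₃ : IsNCArborescence k D₃)
    (hi' : 0 ≤ i') (hj' : 0 ≤ j')
    (h₁' : IsNCArborescence i' D₁') (h₂' : IsNCArborescence j' D₂')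
    (h₃' : IsNCArborescence k' D₃')
    (h : glueEdges i j D₁ D₂ D₃ = glueEdges i' j' D₁' D₂' D₃') :
    i = i' ∧ j = j' ∧ D₁ = D₁' ∧ D₂ = D₂' ∧ D₃ = D₃' := by
  have hw : i + j = i' + j' := by
    have a := (glueEdges_zero (D₁ := D₁) hi hj h₂ h₃).2 (.inr rfl)
    have b := (glueEdges_zero (D₁ := D₁') hi' hj' h₂' h₃').2 (.inr rfl)
    rw [h, glueEdges_zero hi' hj' h₂' h₃'] at a
    rw [← h, glueEdges_zero hi hj h₂ h₃] at b
    have a' : i + j + 1 ≤ i' + j' + 1 := by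
      rcases a with a | a
      · have := h₁'.supp a; omega
      · exact a.le
    have b' : i' + j' + 1 ≤ i + j + 1 := by
      rcases b with a | a
      · have := h₁.supp a; omega
      · exact a.le
    omega
  have hii : i = i' := by
    have a := glueEdges_reach_succ (i := i) (D₁ := D₁) (D₃ := D₃) hj h₂
    have b := glueEdges_reach_succ (i := i') (D₁ := D₁') (D₃ := D₃') hj' h₂'
    rw [h, hw] at a
    rw [← h, ← hw] at b
    have a' := glueEdges_descendant hj' h₁' h₂' h₃' a
    have b' := glueEdges_descendant hj h₁ h₂ h₃ b
    omega
  subst hii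
  obtain rfl : j = j' := by omega
  refine ⟨rfl, rfl, ?_, ?_, ?_⟩ <;> ext x y
  · rw [glueEdges_left_iff hj h₁ h₂ h₃, h, ← glueEdges_left_iff hj h₁' h₂' h₃']
  · rw [glueEdges_middle_iff h₁ h₂ h₃, h, ← glueEdges_middle_iff h₁' h₂' h₃']
  · rw [glueEdges_right_iff hj h₁ h₂ h₃, h, ← glueEdges_right_iff hj h₁' h₂' h₃']

theorem glueLabels_injective {b b' : ℤ} {f₁ f₂ f₃ f₁' f₂' f₃' : ℤ → ℤ} (hi : 0 ≤ i) (hj : 0 ≤ j)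
    (hk : 0 ≤ k) (h₂ : f₂ 0 = 0) (h₃ : f₃ 0 = 0) (h₂' : f₂' 0 = 0) (h₃' : f₃' 0 = 0)
    (h : ∀ x, 0 ≤ x → x ≤ i + j + k + 1 →
      glueLabels i j b f₁ f₂ f₃ x = glueLabels i j b' f₁' f₂' f₃' x) :
    b = b' ∧ (∀ x, 0 ≤ x → x ≤ i → f₁ x = f₁' x) ∧ (∀ x, 0 ≤ x → x ≤ j → f₂ x = f₂' x) ∧
      ∀ x, 0 ≤ x → x ≤ k → f₃ x = f₃' x := by
  have e1 : ∀ x, 0 ≤ x → x ≤ i → f₁ x = f₁' x := fun x hx hx' => by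
    have := h x hx (by omega)
    rwa [glueLabels_left hx', glueLabels_left hx'] at this
  have hii := e1 i hi le_rfl
  have eb : b = b' := by
    have := h (i + 1) (by omega) (by omega)
    rw [glueLabels_middle (by omega) (by omega), glueLabels_middle (by omega) (by omega),
      show i + j + 1 - (i + 1) = j by ring] at this
    omega
  have ej : f₂ j = f₂' j := by
    have := h (i + j + 1) (by omega) (by omega)
    rw [glueLabels_middle (by omega) (by omega), glueLabels_middle (by omega) (by omega),
      sub_self] at this
    omega
  refine ⟨eb, e1, fun x hx hx' => ?_, fun x hx hx' => ?_⟩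
  · have := h (i + j + 1 - x) (by omega) (by omega)
    rw [glueLabels_middle (by omega) (by omega), glueLabels_middle (by omega) (by omega),
      sub_sub_cancel] at this
    omega
  · have := h (x + (i + j + 1)) (by omega) (by omega)
    rw [glueLabels_right hj h₂ h₃ (by omega), glueLabels_right hj h₂' h₃' (by omega),
      add_sub_cancel_right] at this
    omega

end Injective

/-! ### Patterns in a glued tree -/

/-- Some ascent is followed by a descent. -/
def HasAscentDescent (D : ℤ → ℤ → Prop) (f : ℤ → ℤ) : Prop :=
  ∃ x y z, D x y ∧ D y z ∧ f x < f y ∧ f z < f y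

/-- Some descent is followed by an ascent. -/
def HasDescentAscent (D : ℤ → ℤ → Prop) (f : ℤ → ℤ) : Prop :=
  ∃ x y z, D x y ∧ D y z ∧ f y < f x ∧ f y < f z

/-- Some edge from the root is an ascent. -/
def HasRootAscent (D : ℤ → ℤ → Prop) (f : ℤ → ℤ) : Prop :=
  ∃ y, D 0 y ∧ f 0 < f y

/-- All labels on `0, …, n` vanish. -/
def IsFlat (n : ℤ) (f : ℤ → ℤ) : Prop :=
  ∀ x, 0 ≤ x → x ≤ n → f x = 0

theorem IsSlowLabelling.isFlat_iff {n : ℤ} {f : ℤ → ℤ} (hn : 0 ≤ n) (hf : IsSlowLabelling n f) :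
    IsFlat n f ↔ f n = 0 := by
  refine ⟨fun h => h n hn le_rfl, fun h x hx hx' => ?_⟩
  have := hf.mono hx hx' le_rfl
  have := hf.nonneg hx hx'
  omega

section Patterns

variable {i j k b : ℤ} {D₁ D₂ D₃ : ℤ → ℤ → Prop} {f₁ f₂ f₃ : ℤ → ℤ}

/-- Labels increase, so the last child has the largest label among the children of the root; its
label `f₁ i + b + f₂ j` vanishes only if all three terms do. -/
theorem hasRootAscent_glue (hi : 0 ≤ i) (hj : 0 ≤ j) (hb : b = 0 ∨ b = 1)
    (h₁ : IsNCArborescence i D₁) (h₂ : IsNCArborescence j D₂) (h₃ : IsNCArborescence k D₃)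
    (g₁ : IsSlowLabelling i f₁) (g₂ : IsSlowLabelling j f₂) :
    HasRootAscent (glueEdges i j D₁ D₂ D₃) (glueLabels i j b f₁ f₂ f₃) ↔
      ¬ (IsFlat i f₁ ∧ b = 0 ∧ IsFlat j f₂) := by
  have n₁ := g₁.nonneg hi le_rfl
  have n₂ := g₂.nonneg hj le_rfl
  have hw : glueLabels i j b f₁ f₂ f₃ (i + j + 1) = f₁ i + b + f₂ j := by
    rw [glueLabels_middle (by omega) le_rfl, sub_self, g₂.zero, sub_zero]
  rw [g₁.isFlat_iff hi, g₂.isFlat_iff hj]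
  simp only [HasRootAscent, glueEdges_zero hi hj h₂ h₃]
  rw [glueLabels_left hi, g₁.zero]
  constructor
  · rintro ⟨y, h | rfl, hy⟩
    · have hs := h₁.supp h
      rw [glueLabels_left hs.2.2.2] at hy
      have := g₁.mono hs.2.2.1.le hs.2.2.2 le_rfl
      omega
    · omega
  · exact fun h => ⟨_, .inr rfl, by omega⟩

/-- The new edge leaves the root, which has the least label, so it is no descent and cannot start
the pattern; nor can it end it, as no edge enters the root. The other occurrences lie in one part,
and reflection swaps the pattern in the middle one. -/
theorem hasDescentAscent_glue (hi : 0 ≤ i) (hj : 0 ≤ j) (hb : b = 0 ∨ b = 1)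
    (h₁ : IsNCArborescence i D₁) (h₂ : IsNCArborescence j D₂) (h₃ : IsNCArborescence k D₃)
    (g₁ : IsSlowLabelling i f₁) (g₂ : IsSlowLabelling j f₂) (g₃ : IsSlowLabelling k f₃) :
    HasDescentAscent (glueEdges i j D₁ D₂ D₃) (glueLabels i j b f₁ f₂ f₃) ↔
      HasDescentAscent D₁ f₁ ∨ HasAscentDescent D₂ f₂ ∨ HasDescentAscent D₃ f₃ := by
  have n₁ := g₁.nonneg hi le_rfl
  have n₂ := g₂.nonneg hj le_rfl
  have l₁ : ∀ {x}, x ≤ i → _ :=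
    fun h => glueLabels_left (j := j) (b := b) (f₁ := f₁) (f₂ := f₂) (f₃ := f₃) h
  have l₂ : ∀ {x}, i < x → x ≤ i + j + 1 → _ :=
    fun h h' => glueLabels_middle (b := b) (f₁ := f₁) (f₂ := f₂) (f₃ := f₃) h h'
  have l₃ : ∀ {x}, i + j + 1 ≤ x → _ :=
    fun h => glueLabels_right (b := b) (f₁ := f₁) hj g₂.zero g₃.zero h
  constructor
  · rintro ⟨x, y, z, h, g, hf, hf'⟩
    rcases h with h | ⟨rfl, rfl⟩ | h | h
    · have hs := h₁.supp h
      rcases g with g | g | g | g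
      · have gs := h₁.supp g
        rw [l₁ (by omega), l₁ (by omega)] at hf hf'
        exact .inl ⟨x, y, z, h, g, hf, hf'⟩
      · omega
      · have gs := h₂.supp g; omega
      · have gs := h₃.supp g; omega
    · rw [l₁ hi, l₂ (by omega) le_rfl, sub_self, g₁.zero, g₂.zero] at hf
      omega
    · have hs := h₂.supp h
      rcases g with g | g | g | g
      · have gs := h₁.supp g; omega
      · omega
      · have gs := h₂.supp g
        rw [l₂ (by omega) (by omega), l₂ (by omega) (by omega)] at hf hf'
        exact .inr (.inl ⟨_, _, _, h, g, by omega, by omega⟩)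
      · have gs := h₃.supp g; omega
    · have hs := h₃.supp h
      rcases g with g | g | g | g
      · have gs := h₁.supp g; omega
      · omega
      · have gs := h₂.supp g; omega
      · have gs := h₃.supp g
        rw [l₃ (by omega), l₃ (by omega)] at hf hf'
        exact .inr (.inr ⟨_, _, _, h, g, by omega, by omega⟩)
  · rintro (⟨x, y, z, h, g, hf, hf'⟩ | ⟨x, y, z, h, g, hf, hf'⟩ | ⟨x, y, z, h, g, hf, hf'⟩)
    · have hs := h₁.supp h
      have gs := h₁.supp g
      refine ⟨x, y, z, .inl h, .inl g, ?_, ?_⟩ <;> rw [l₁ (by omega), l₁ (by omega)] <;> assumption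
    · have hs := h₂.supp h
      have gs := h₂.supp g
      refine ⟨i + j + 1 - x, i + j + 1 - y, i + j + 1 - z, .inr (.inr (.inl (by simpa using h))),
        .inr (.inr (.inl (by simpa using g))), ?_, ?_⟩ <;>
      rw [l₂ (by omega) (by omega), l₂ (by omega) (by omega), sub_sub_cancel, sub_sub_cancel] <;>
      omega
    · have hs := h₃.supp h
      have gs := h₃.supp g
      refine ⟨x + (i + j + 1), y + (i + j + 1), z + (i + j + 1),
        .inr (.inr (.inr (by simpa using h))), .inr (.inr (.inr (by simpa using g))), ?_, ?_⟩ <;>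
      rw [l₃ (by omega), l₃ (by omega), add_sub_cancel_right, add_sub_cancel_right] <;>
      omega

/-- Here the new edge can start the pattern. The following descent must go into the reflected part,
where it is a root ascent; conversely a root ascent there gives `f₂ j > 0`, which makes the new edge
an ascent. -/
theorem hasAscentDescent_glue (hi : 0 ≤ i) (hj : 0 ≤ j) (hb : b = 0 ∨ b = 1)
    (h₁ : IsNCArborescence i D₁) (h₂ : IsNCArborescence j D₂) (h₃ : IsNCArborescence k D₃)
    (g₁ : IsSlowLabelling i f₁) (g₂ : IsSlowLabelling j f₂) (g₃ : IsSlowLabelling k f₃) :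
    HasAscentDescent (glueEdges i j D₁ D₂ D₃) (glueLabels i j b f₁ f₂ f₃) ↔
      HasAscentDescent D₁ f₁ ∨ (HasDescentAscent D₂ f₂ ∨ HasRootAscent D₂ f₂) ∨
        HasAscentDescent D₃ f₃ := by
  have n₁ := g₁.nonneg hi le_rfl
  have n₂ := g₂.nonneg hj le_rfl
  have l₁ : ∀ {x}, x ≤ i → _ :=
    fun h => glueLabels_left (j := j) (b := b) (f₁ := f₁) (f₂ := f₂) (f₃ := f₃) h
  have l₂ : ∀ {x}, i < x → x ≤ i + j + 1 → _ :=
    fun h h' => glueLabels_middle (b := b) (f₁ := f₁) (f₂ := f₂) (f₃ := f₃) h h'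
  have l₃ : ∀ {x}, i + j + 1 ≤ x → _ :=
    fun h => glueLabels_right (b := b) (f₁ := f₁) hj g₂.zero g₃.zero h
  constructor
  · rintro ⟨x, y, z, h, g, hf, hf'⟩
    rcases h with h | ⟨rfl, rfl⟩ | h | h
    · have hs := h₁.supp h
      rcases g with g | g | g | g
      · have gs := h₁.supp g
        rw [l₁ (by omega), l₁ (by omega)] at hf hf'
        exact .inl ⟨x, y, z, h, g, hf, hf'⟩
      · omega
      · have gs := h₂.supp g; omega
      · have gs := h₃.supp g; omega
    · rcases g with g | g | g | g
      · have gs := h₁.supp g; omega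
      · omega
      · have gs := h₂.supp g
        rw [l₂ (by omega) (by omega), l₂ (by omega) (by omega)] at hf'
        rw [sub_self] at g hf'
        exact .inr (.inl (.inr ⟨_, g, by omega⟩))
      · have gs := h₃.supp g
        have := g₃.nonneg gs.2.2.1.le gs.2.2.2
        rw [l₃ (by omega), l₃ (by omega), sub_self, g₃.zero] at hf'
        omega
    · have hs := h₂.supp h
      rcases g with g | g | g | g
      · have gs := h₁.supp g; omega
      · omega
      · have gs := h₂.supp g
        rw [l₂ (by omega) (by omega), l₂ (by omega) (by omega)] at hf hf'
        exact .inr (.inl (.inl ⟨_, _, _, h, g, by omega, by omega⟩))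
      · have gs := h₃.supp g; omega
    · have hs := h₃.supp h
      rcases g with g | g | g | g
      · have gs := h₁.supp g; omega
      · omega
      · have gs := h₂.supp g; omega
      · have gs := h₃.supp g
        rw [l₃ (by omega), l₃ (by omega)] at hf hf'
        exact .inr (.inr ⟨_, _, _, h, g, by omega, by omega⟩)
  · rintro (⟨x, y, z, h, g, hf, hf'⟩ | (⟨x, y, z, h, g, hf, hf'⟩ | ⟨y, h, hf⟩) |
      ⟨x, y, z, h, g, hf, hf'⟩)
    · have hs := h₁.supp h
      have gs := h₁.supp g
      refine ⟨x, y, z, .inl h, .inl g, ?_, ?_⟩ <;> rw [l₁ (by omega), l₁ (by omega)] <;> assumption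
    · have hs := h₂.supp h
      have gs := h₂.supp g
      refine ⟨i + j + 1 - x, i + j + 1 - y, i + j + 1 - z, .inr (.inr (.inl (by simpa using h))),
        .inr (.inr (.inl (by simpa using g))), ?_, ?_⟩ <;>
      rw [l₂ (by omega) (by omega), l₂ (by omega) (by omega), sub_sub_cancel, sub_sub_cancel] <;>
      omega
    · have hs := h₂.supp h
      have := g₂.mono hs.2.2.1.le hs.2.2.2 le_rfl
      refine ⟨0, i + j + 1, i + j + 1 - y, .inr (.inl ⟨rfl, rfl⟩),
        .inr (.inr (.inl (by simpa using h))), ?_, ?_⟩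
      · rw [l₁ hi, l₂ (by omega) (by omega), sub_self, g₁.zero]
        have := g₂.zero
        omega
      · rw [l₂ (by omega) (by omega), l₂ (by omega) (by omega), sub_sub_cancel, sub_self]
        omega
    · have hs := h₃.supp h
      have gs := h₃.supp g
      refine ⟨x + (i + j + 1), y + (i + j + 1), z + (i + j + 1),
        .inr (.inr (.inr (by simpa using h))), .inr (.inr (.inr (by simpa using g))), ?_, ?_⟩ <;>
      rw [l₃ (by omega), l₃ (by omega), add_sub_cancel_right, add_sub_cancel_right] <;>
      omega

end Patterns

/-! ### Ternary trees encoding labelled non-crossing trees -/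

/-- Labelled non-crossing trees, decomposed at the last child of the root: the tree without the
branch of the last child, the bit telling whether the label increases between the two, and the
parts of the branch to the left and to the right of the last child. -/
inductive ButterflyTree where
  | leaf
  | node (T : ButterflyTree) (b : Bool) (L R : ButterflyTree)

namespace ButterflyTree

/-- The number of edges. -/
def size : ButterflyTree → ℕ
  | leaf => 0
  | node T _ L R => T.size + L.size + R.size + 1

/-- The parent-child relation on the points `0, …, size`. -/
def edges : ButterflyTree → ℤ → ℤ → Prop
  | leaf => fun _ _ => False
  | node T _ L R => glueEdges T.size L.size T.edges L.edges R.edges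

/-- The labels of the points `0, …, size`, starting from `0`. -/
def labels : ButterflyTree → ℤ → ℤ
  | leaf => fun _ => 0
  | node T b L R => glueLabels T.size L.size (if b then 1 else 0) T.labels L.labels R.labels

theorem ite_eq_zero_or_one (b : Bool) :
    (if b then 1 else 0 : ℤ) = 0 ∨ (if b then 1 else 0 : ℤ) = 1 := by
  cases b <;> simp

theorem isNCArborescence (t : ButterflyTree) : IsNCArborescence t.size t.edges := by
  induction t with
  | leaf =>
    refine ⟨fun h => h.elim, fun {x} h h' => ?_, fun h => h.elim,
      fun _ _ _ h => (h.elim id id).elim⟩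
    obtain rfl : x = 0 := by simp only [size] at h'; omega
    exact .refl
  | node T b L R hT hL hR =>
    simpa [size, edges] using hT.glue (by omega) (by omega) (by omega) hL hR

theorem isSlowLabelling (t : ButterflyTree) : IsSlowLabelling t.size t.labels := by
  induction t with
  | leaf => exact ⟨rfl, fun _ _ => .inl rfl⟩
  | node T b L R hT hL hR =>
    simpa [size, labels] using hT.glue (by omega) (by omega) (ite_eq_zero_or_one b) hL hR

theorem eq_of_edges_eq {s t : ButterflyTree} (hs : s.size = t.size) (he : s.edges = t.edges)
    (hl : ∀ x : ℤ, 0 ≤ x → x ≤ s.size → s.labels x = t.labels x) : s = t := by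
  induction s generalizing t with
  | leaf =>
    cases t with
    | leaf => rfl
    | node => simp [size] at hs
  | node T b L R hT hL hR =>
    cases t with
    | leaf => simp [size] at hs
    | node T' b' L' R' =>
      obtain ⟨h1, h2, h3, h4, h5⟩ := glueEdges_injective (Int.natCast_nonneg _) (Int.natCast_nonneg _)
        T.isNCArborescence L.isNCArborescence R.isNCArborescence (Int.natCast_nonneg _)
        (Int.natCast_nonneg _)
        T'.isNCArborescence L'.isNCArborescence R'.isNCArborescence he
      simp only [size, labels, ← h1, ← h2] at hs hl
      obtain ⟨l1, l2, l3, l4⟩ := glueLabels_injective (k := R.size) (Int.natCast_nonneg _)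
        (Int.natCast_nonneg _) (Int.natCast_nonneg _) L.isSlowLabelling.zero R.isSlowLabelling.zero L'.isSlowLabelling.zero
        R'.isSlowLabelling.zero (by exact_mod_cast hl)
      rw [hT (by omega) h3 l2, hL (by omega) h4 l3, hR (by omega) h5 l4]
      congr 1
      revert l1
      cases b <;> cases b' <;> simp

theorem exists_edges_eq (n : ℕ) {D : ℤ → ℤ → Prop} {f : ℤ → ℤ} (hD : IsNCArborescence n D)
    (hf : IsSlowLabelling n f) :
    ∃ t : ButterflyTree, t.size = n ∧ t.edges = D ∧
      ∀ x : ℤ, 0 ≤ x → x ≤ n → t.labels x = f x := by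
  induction n using Nat.strong_induction_on generalizing D f with
  | _ n ih =>
    rcases Nat.eq_zero_or_pos n with rfl | hn
    · refine ⟨leaf, rfl, ?_, fun x hx hx' => ?_⟩
      · ext x y
        refine ⟨fun h => h.elim, fun h => ?_⟩
        have := hD.supp h
        omega
      · obtain rfl : x = 0 := by omega
        exact hf.zero.symm
    obtain ⟨i, j, k, D₁, D₂, D₃, hi, hj, hk, hs, h₁, h₂, h₃, rfl⟩ :=
      hD.exists_glue (by omega)
    rw [hs] at hf
    obtain ⟨b, f₁, f₂, f₃, hb, g₁, g₂, g₃, rfl⟩ := hf.exists_glue hi hj hk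
    lift i to ℕ using hi
    lift j to ℕ using hj
    lift k to ℕ using hk
    obtain ⟨T, rfl, rfl, hT⟩ := ih i (by omega) h₁ g₁
    obtain ⟨L, rfl, rfl, hL⟩ := ih j (by omega) h₂ g₂
    obtain ⟨R, rfl, rfl, hR⟩ := ih k (by omega) h₃ g₃
    refine ⟨node T (decide (b = 1)) L R, by simp only [size]; omega, rfl, fun x hx hx' => ?_⟩
    -- The increase is `0` or `1`, so storing it as a Boolean loses nothing.
    have hbb : (if decide (b = 1) = true then 1 else 0 : ℤ) = b := by
      rcases hb with rfl | rfl <;> simp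
    simp only [labels, hbb, glueLabels]
    split_ifs with h1 h2
    · exact hT x hx h1
    · rw [hT _ (by omega) le_rfl, hL _ (by omega) le_rfl, hL _ (by omega) (by omega)]
    · rw [hT _ (by omega) le_rfl, hL _ (by omega) le_rfl, hR _ (by omega) (by omega)]

/-- No ascent is followed by a descent. -/
def AvoidsAscentDescent (t : ButterflyTree) : Prop := ¬ HasAscentDescent t.edges t.labels

/-- No descent is followed by an ascent. -/
def AvoidsDescentAscent (t : ButterflyTree) : Prop := ¬ HasDescentAscent t.edges t.labels

/-- All labels agree. -/
def Flat (t : ButterflyTree) : Prop := IsFlat t.size t.labels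

/-- No descent is followed by an ascent, and the root has no ascents. -/
def AvoidsWithoutRootAscent (t : ButterflyTree) : Prop :=
  t.AvoidsDescentAscent ∧ ¬ HasRootAscent t.edges t.labels

section Node

variable {T L R : ButterflyTree} {b : Bool}

theorem avoidsAscentDescent_node : (node T b L R).AvoidsAscentDescent ↔
    T.AvoidsAscentDescent ∧ L.AvoidsWithoutRootAscent ∧ R.AvoidsAscentDescent := by
  simp only [AvoidsAscentDescent, AvoidsWithoutRootAscent, AvoidsDescentAscent, edges, labels]
  rw [hasAscentDescent_glue (by omega) (by omega) (ite_eq_zero_or_one b) T.isNCArborescence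
    L.isNCArborescence R.isNCArborescence T.isSlowLabelling L.isSlowLabelling R.isSlowLabelling]
  tauto

theorem avoidsDescentAscent_node : (node T b L R).AvoidsDescentAscent ↔
    T.AvoidsDescentAscent ∧ L.AvoidsAscentDescent ∧ R.AvoidsDescentAscent := by
  simp only [AvoidsAscentDescent, AvoidsDescentAscent, edges, labels]
  rw [hasDescentAscent_glue (by omega) (by omega) (ite_eq_zero_or_one b) T.isNCArborescence
    L.isNCArborescence R.isNCArborescence T.isSlowLabelling L.isSlowLabelling R.isSlowLabelling]
  tauto

theorem Flat.labels_eq {t : ButterflyTree} (h : t.Flat) {x y : ℤ} (hxy : t.edges x y) :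
    t.labels x = t.labels y := by
  have := t.isNCArborescence.supp hxy
  rw [h x (by omega) (by omega), h y (by omega) (by omega)]

theorem Flat.avoidsAscentDescent {t : ButterflyTree} (h : t.Flat) : t.AvoidsAscentDescent := by
  rintro ⟨x, y, z, hxy, -, hlt, -⟩
  exact hlt.ne (h.labels_eq hxy)

theorem Flat.avoidsDescentAscent {t : ButterflyTree} (h : t.Flat) : t.AvoidsDescentAscent := by
  rintro ⟨x, y, z, hxy, -, hlt, -⟩
  exact hlt.ne' (h.labels_eq hxy)

/-- Without a root ascent all labels up to the last root child vanish, so `T` and `L` avoid both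
patterns automatically; only `R` may still have varying labels. -/
theorem avoidsWithoutRootAscent_node : (node T b L R).AvoidsWithoutRootAscent ↔
    T.Flat ∧ b = false ∧ L.Flat ∧ R.AvoidsDescentAscent := by
  rw [AvoidsWithoutRootAscent, avoidsDescentAscent_node]
  simp only [edges, labels]
  rw [hasRootAscent_glue (by omega) (by omega) (ite_eq_zero_or_one b) T.isNCArborescence
    L.isNCArborescence R.isNCArborescence T.isSlowLabelling L.isSlowLabelling]
  have hT := Flat.avoidsDescentAscent (t := T)
  have hL := Flat.avoidsAscentDescent (t := L)
  simp only [Flat] at hT hL ⊢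
  cases b
  · simp; tauto
  · simp

end Node

theorem not_hasRootAscent_leaf : ¬ HasRootAscent leaf.edges leaf.labels :=
  fun ⟨_, h, _⟩ => h

theorem avoidsAscentDescent_leaf : leaf.AvoidsAscentDescent := fun ⟨_, _, _, h, _⟩ => h

theorem avoidsDescentAscent_leaf : leaf.AvoidsDescentAscent := fun ⟨_, _, _, h, _⟩ => h

/-! ### Generating functions of the ternary trees -/

theorem finite_size_le (n : ℕ) : {t : ButterflyTree | t.size ≤ n}.Finite := by
  induction n with
  | zero =>
    refine (Set.finite_singleton leaf).subset fun t ht => ?_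
    cases t with
    | leaf => rfl
    | node => simp [size] at ht
  | succ n ih =>
    refine ((Set.finite_singleton leaf).union (((ih.prod (Set.finite_univ (α := Bool))).prod
      (ih.prod ih)).image fun p => node p.1.1 p.1.2 p.2.1 p.2.2)).subset fun t ht => ?_
    cases t with
    | leaf => exact .inl rfl
    | node T b L R =>
      simp only [size, Set.mem_ofPred_eq] at ht
      exact .inr ⟨((T, b), (L, R)), by simp; omega, rfl⟩

theorem finite_size_eq (n : ℕ) : {t : ButterflyTree | t.size = n}.Finite := by
  refine (finite_size_le n).subset fun t ht => ?_
  simp only [Set.mem_ofPred_eq] at ht ⊢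
  exact ht.le

/-- The trees with `n` edges. -/
noncomputable def ofSize (n : ℕ) : Finset ButterflyTree :=
  (finite_size_eq n).toFinset

theorem mem_ofSize {n : ℕ} {t : ButterflyTree} : t ∈ ofSize n ↔ t.size = n := by
  simp [ofSize]

open Classical in
/-- The generating function of the trees that satisfy `P`. -/
noncomputable def genFun (R : Type*) [CommRing R] (P : ButterflyTree → Prop) : PowerSeries R :=
  PowerSeries.mk fun n => (((ofSize n).filter P).card : R)

-- A property that factors through the node data gives a product of series: `X` for the edge to the
-- last root child and `#S` for the allowed bits.
open Classical Finset in
theorem genFun_eq (R : Type*) [CommRing R] {P P₁ P₂ P₃ : ButterflyTree → Prop} {S : Finset Bool}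
    (h0 : P leaf) (h : ∀ T b L R, P (node T b L R) ↔ P₁ T ∧ b ∈ S ∧ P₂ L ∧ P₃ R) :
    genFun R P = 1 + (#S : PowerSeries R) * PowerSeries.X *
      (genFun R P₁ * (genFun R P₂ * genFun R P₃)) := by
  have hcard : ∀ n, #((ofSize (n + 1)).filter P) = ∑ p ∈ antidiagonal n, ∑ q ∈ antidiagonal p.2,
      #S * (#((ofSize p.1).filter P₁) * (#((ofSize q.1).filter P₂) *
        #((ofSize q.2).filter P₃))) := by
    intro n
    simp_rw [← card_product, ← card_sigma]
    -- The outer antidiagonal separates the size of `T` from the rest, the inner one the sizes of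
    -- `L` and `R`.
    refine (card_bij (fun x _ => node x.2.2.2.1 x.2.2.1 x.2.2.2.2.1 x.2.2.2.2.2) ?_ ?_ ?_).symm
    · rintro ⟨p, q, b, T, L, R⟩ hx
      simp only [mem_sigma, HasAntidiagonal.mem_antidiagonal, mem_product, mem_filter,
        mem_ofSize] at hx
      simp only [mem_filter, mem_ofSize, size, h]
      refine ⟨by omega, hx.2.2.2.1.2, hx.2.2.1, hx.2.2.2.2.1.2, hx.2.2.2.2.2.2⟩
    · rintro ⟨⟨p, p'⟩, ⟨q, q'⟩, b, T, L, R⟩ hx ⟨⟨r, r'⟩, ⟨s, s'⟩, b', T', L', R'⟩ hy hxy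
      simp only [mem_sigma, HasAntidiagonal.mem_antidiagonal, mem_product, mem_filter,
        mem_ofSize] at hx hy
      simp only [node.injEq] at hxy
      obtain ⟨rfl, rfl, rfl, rfl⟩ := hxy
      obtain rfl : p = r := by omega
      obtain rfl : p' = r' := by omega
      obtain rfl : q = s := by omega
      obtain rfl : q' = s' := by omega
      rfl
    · intro t ht
      simp only [mem_filter, mem_ofSize] at ht
      cases t with
      | leaf => simp [size] at ht
      | node T b L R =>
        simp only [size, h] at ht
        refine ⟨⟨(T.size, L.size + R.size), (L.size, R.size), b, T, L, R⟩, ?_, rfl⟩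
        simp only [mem_sigma, HasAntidiagonal.mem_antidiagonal, mem_product, mem_filter, true_and,
          mem_ofSize]
        exact ⟨by omega, ht.2.2.1, ht.2.1, ht.2.2.2⟩
  ext n
  cases n with
  | zero =>
    have : (ofSize 0).filter P = {leaf} := by
      ext t
      simp only [mem_filter, mem_ofSize, mem_singleton]
      cases t with
      | leaf => simp [size, h0]
      | node => simp [size]
    simp [genFun, this, mul_assoc]
  | succ n =>
    rw [map_add, PowerSeries.coeff_one, if_neg (by omega), zero_add, mul_assoc,
      ← map_natCast (PowerSeries.C (R := R)), PowerSeries.coeff_C_mul,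
      PowerSeries.coeff_succ_X_mul, PowerSeries.coeff_mul]
    simp only [PowerSeries.coeff_mul, genFun, PowerSeries.coeff_mk, hcard]
    push_cast
    simp only [mul_sum]

theorem genFun_avoidsAscentDescent (R : Type*) [CommRing R] :
    genFun R AvoidsAscentDescent = 1 + 2 * PowerSeries.X * genFun R AvoidsAscentDescent ^ 2 *
      (1 + PowerSeries.X * genFun R Flat ^ 2 * genFun R AvoidsDescentAscent) := by
  -- Cutting the reflected left part a second time; its bit must be `false`, so no factor 2 appears
  -- here.
  have h2 := genFun_eq R (P := AvoidsWithoutRootAscent) (S := {false})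
    ⟨avoidsDescentAscent_leaf, not_hasRootAscent_leaf⟩
    (fun T b L R => by rw [avoidsWithoutRootAscent_node, Finset.mem_singleton])
  have h1 := genFun_eq R avoidsAscentDescent_leaf
    (S := Finset.univ) (fun T b L R => by
      simpa only [Finset.mem_univ, true_and] using avoidsAscentDescent_node)
  rw [h2] at h1
  conv_lhs => rw [h1]
  simp only [Finset.card_univ, Fintype.card_bool, Finset.card_singleton]
  push_cast
  ring

theorem genFun_avoidsDescentAscent (R : Type*) [CommRing R] :
    genFun R AvoidsDescentAscent = 1 + 2 * PowerSeries.X * genFun R AvoidsDescentAscent ^ 2 *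
      genFun R AvoidsAscentDescent := by
  conv_lhs => rw [genFun_eq R avoidsDescentAscent_leaf
    (S := Finset.univ) (fun T b L R => by
      simpa only [Finset.mem_univ, true_and] using avoidsDescentAscent_node)]
  simp only [Finset.card_univ, Fintype.card_bool]
  push_cast
  ring

end ButterflyTree

/-! ### From GNC-trees to integer arborescences -/

namespace GNCTree

variable {n : ℕ} (T : GNCTree n)

theorem label_zero : T.label 0 = 1 := by
  obtain ⟨w, hw⟩ := T.label_full 0 1 le_rfl (T.label_pos 0)
  have := T.label_mono (Fin.zero_le w)
  have := T.label_pos 0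
  omega

variable {T}

theorem IsEdge.exists_path {v w : Fin (n + 1)} (h : T.IsEdge v w) :
    ∃ p : T.graph.Walk 0 v, p.IsPath ∧ w ∉ p.support := by
  obtain ⟨hadj, q, hq, hv⟩ := h
  exact ⟨q.takeUntil v hv, hq.takeUntil hv,
    Walk.endpoint_notMem_support_takeUntil hq hv hadj.ne'⟩

theorem IsEdge.penultimate_eq {v w : Fin (n + 1)} (h : T.IsEdge v w) {p : T.graph.Walk 0 w}
    (hp : p.IsPath) : p.penultimate = v := by
  obtain ⟨q, hq, hw⟩ := h.exists_path
  rw [(T.isTree.existsUnique_path 0 w).unique hp (hq.concat hw h.1), Walk.penultimate_concat]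

theorem IsEdge.parent_unique {u v w : Fin (n + 1)} (h : T.IsEdge u w) (h' : T.IsEdge v w) :
    u = v := by
  obtain ⟨p, hp, -⟩ := h.2
  rw [← h.penultimate_eq hp, h'.penultimate_eq hp]

theorem IsEdge.asymm {v w : Fin (n + 1)} (h : T.IsEdge v w) (h' : T.IsEdge w v) : False := by
  obtain ⟨q, hq, hw⟩ := h.exists_path
  obtain ⟨-, p, hp, hw'⟩ := h'
  rw [(T.isTree.existsUnique_path 0 v).unique hp hq] at hw'
  exact hw hw'

theorem IsEdge.ne_zero {v w : Fin (n + 1)} (h : T.IsEdge v w) : w ≠ 0 := by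
  rintro rfl
  obtain ⟨q, hq, hw⟩ := h.exists_path
  exact hw q.start_mem_support

theorem adj_iff {v w : Fin (n + 1)} : T.graph.Adj v w ↔ T.IsEdge v w ∨ T.IsEdge w v := by
  refine ⟨fun h => ?_, fun h => h.elim (fun h => h.1) fun h => h.1.symm⟩
  obtain ⟨p, hp, -⟩ := T.isTree.existsUnique_path 0 v
  by_cases hw : w ∈ p.support
  · exact .inr ⟨h.symm, p, hp, hw⟩
  · exact .inl ⟨h, p.concat h, hp.concat hw h, by simp [Walk.support_concat]⟩

theorem reflTransGen_isEdge_of_isPath {v w : Fin (n + 1)} (p : T.graph.Walk v w) (hv : v = 0)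
    (hp : p.IsPath) : ReflTransGen T.IsEdge 0 w := by
  induction p using Walk.concatRec with
  | Hnil => rw [hv]
  | Hconcat p h ih =>
    subst hv
    exact (ih rfl ((Walk.concat_isPath_iff h).1 hp).1).tail
      ⟨h, p.concat h, hp, by simp [Walk.support_concat]⟩

theorem reflTransGen_isEdge (w : Fin (n + 1)) : ReflTransGen T.IsEdge 0 w := by
  obtain ⟨p, hp, -⟩ := T.isTree.existsUnique_path 0 w
  exact reflTransGen_isEdge_of_isPath p rfl hp

variable (T)

/-- `IsEdge` as a relation between integers. -/
def edgeRel (x y : ℤ) : Prop := ∃ v w : Fin (n + 1), T.IsEdge v w ∧ (v : ℤ) = x ∧ (w : ℤ) = y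

/-- The labels, shifted to start from `0`, as a function on the integers. -/
def labelFun (x : ℤ) : ℤ := T.label (Fin.ofNat (n + 1) x.toNat) - 1

theorem labelFun_coe (v : Fin (n + 1)) : T.labelFun v = T.label v - 1 := by
  rw [labelFun, Int.toNat_natCast, show Fin.ofNat (n + 1) v = v from
    Fin.ext (Nat.mod_eq_of_lt v.2)]

theorem edgeRel_coe (v w : Fin (n + 1)) : T.edgeRel v w ↔ T.IsEdge v w := by
  constructor
  · rintro ⟨v', w', h, hv, hw⟩
    obtain rfl : v' = v := Fin.ext (by exact_mod_cast hv)
    obtain rfl : w' = w := Fin.ext (by exact_mod_cast hw)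
    exact h
  · exact fun h => ⟨v, w, h, rfl, rfl⟩

theorem isNCArborescence : IsNCArborescence n T.edgeRel where
  supp := by
    rintro x y ⟨v, w, h, rfl, rfl⟩
    have := v.2
    have := w.2
    have := Fin.val_ne_zero_iff.2 h.ne_zero
    omega
  reach := by
    intro x hx hx'
    have := ReflTransGen.lift (p := T.edgeRel) (fun v : Fin (n + 1) => (v : ℤ))
      (fun v w h => ⟨v, w, h, rfl, rfl⟩) _ _ (reflTransGen_isEdge (T := T) ⟨x.toNat, by omega⟩)
    simpa [Function.onFun, hx] using this
  parent := by
    rintro x y z ⟨u, w, h, rfl, rfl⟩ ⟨v, w', h', rfl, hw⟩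
    obtain rfl : w' = w := Fin.ext (by exact_mod_cast hw)
    rw [h.parent_unique h']
  noncrossing := by
    have key : ∀ {x y : ℤ}, T.edgeRel x y ∨ T.edgeRel y x →
        ∃ v w : Fin (n + 1), T.graph.Adj v w ∧ (v : ℤ) = x ∧ (w : ℤ) = y := by
      rintro x y (⟨v, w, h, rfl, rfl⟩ | ⟨v, w, h, rfl, rfl⟩)
      · exact ⟨v, w, h.1, rfl, rfl⟩
      · exact ⟨w, v, h.1.symm, rfl, rfl⟩
    intro a b c d hab hbc hcd h h'
    obtain ⟨a, c, hac, rfl, rfl⟩ := key h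
    obtain ⟨b, d, hbd, rfl, rfl⟩ := key h'
    exact T.noncrossing a b c d (by exact_mod_cast hab) (by exact_mod_cast hbc)
      (by exact_mod_cast hcd) ⟨hac, hbd⟩

theorem isSlowLabelling : IsSlowLabelling n T.labelFun where
  zero := by simpa [T.label_zero] using T.labelFun_coe 0
  step := by
    intro x hx hx'
    lift x to ℕ using hx
    have h1 := T.labelFun_coe ⟨x, by omega⟩
    have h2 := T.labelFun_coe ⟨x + 1, by omega⟩
    push_cast at h1 h2
    rw [h1, h2]
    have h3 := T.label_mono (show (⟨x, by omega⟩ : Fin (n + 1)) ≤ ⟨x + 1, by omega⟩ by simp)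
    -- If the label rose by at least two, the value `T.label x + 1` would be skipped, by
    -- monotonicity on both sides of the gap.
    by_contra hcon
    obtain ⟨w, hw⟩ := T.label_full ⟨x + 1, by omega⟩ (T.label ⟨x, by omega⟩ + 1) (by omega)
      (by omega)
    rcases le_or_gt w ⟨x, by omega⟩ with h | h
    · have := T.label_mono h
      omega
    · have := T.label_mono (show ⟨x + 1, by omega⟩ ≤ w from h)
      omega

end GNCTree

/-! ### From integer arborescences to GNC-trees -/

theorem IsSlowLabelling.exists_eq {n : ℤ} {f : ℤ → ℤ} (hf : IsSlowLabelling n f) {x i : ℤ}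
    (hx : 0 ≤ x) (hxn : x ≤ n) (hi : 0 ≤ i) (hi' : i ≤ f x) : ∃ y, 0 ≤ y ∧ y ≤ x ∧ f y = i := by
  induction x, hx using Int.leInduction with
  | base => exact ⟨0, le_rfl, le_rfl, by have := hf.zero; omega⟩
  | succ m hm ih =>
    rcases le_or_gt i (f m) with h | h
    · obtain ⟨y, h1, h2, h3⟩ := ih (by omega) h
      exact ⟨y, h1, by omega, h3⟩
    · refine ⟨m + 1, by omega, le_rfl, ?_⟩
      rcases hf.step hm (by omega) with h | h <;> omega

/-- A cycle through a vertex also passes through its unique parent, hence can be moved up to the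
root, which no edge enters. -/
theorem IsNCArborescence.not_transGen_self {n : ℤ} {D : ℤ → ℤ → Prop}
    (h : IsNCArborescence n D) (x : ℤ) : ¬ TransGen D x x := by
  intro hx
  have hx0 : ReflTransGen D 0 x := by
    obtain ⟨y, -, hy⟩ := TransGen.tail'_iff.1 hx
    have := h.supp hy
    exact h.reach (by omega) (by omega)
  induction hx0 with
  | refl =>
    obtain ⟨y, -, hy⟩ := TransGen.tail'_iff.1 hx
    have := h.supp hy
    omega
  | tail _ hyz ih =>
    obtain ⟨y, hy, hy'⟩ := TransGen.tail'_iff.1 hx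
    rw [h.parent hy' hyz] at hy
    exact ih (.head' hyz hy)

namespace IsNCArborescence

variable {n : ℕ} {D : ℤ → ℤ → Prop}

/-- The undirected graph of a non-crossing arborescence. -/
def graph (h : IsNCArborescence n D) : SimpleGraph (Fin (n + 1)) where
  Adj v w := D v w ∨ D w v
  symm := ⟨fun _ _ => Or.symm⟩
  loopless := ⟨fun v hv => h.not_transGen_self v (.single (hv.elim id id))⟩

/-- The support consists of ancestors of `w`; with acyclicity, this is why appending an edge to a
child keeps the walk a path. -/
theorem exists_isPath (h : IsNCArborescence n D) (w : Fin (n + 1)) :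
    ∃ p : h.graph.Walk 0 w, p.IsPath ∧ ∀ v ∈ p.support, ReflTransGen D v w := by
  have hw : ReflTransGen D 0 w := h.reach (by omega) (by omega)
  generalize hx : (w : ℤ) = x at hw
  induction hw generalizing w with
  | refl =>
    obtain rfl : w = 0 := Fin.ext (by simpa using hx)
    refine ⟨.nil, .nil, fun v hv => ?_⟩
    rw [Walk.support_nil, List.mem_singleton] at hv
    rw [hv]
    exact .refl
  | @tail y z _ hyz ih =>
    have hy := h.supp hyz
    subst hx
    lift y to ℕ using hy.1
    obtain ⟨p, hp, hps⟩ := ih ⟨y, by omega⟩ rfl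
    have hadj : h.graph.Adj ⟨y, by omega⟩ w := .inl hyz
    refine ⟨p.concat hadj, hp.concat (fun hw => ?_) hadj, fun v hv => ?_⟩
    · exact h.not_transGen_self w (.tail' (hps w hw) hyz)
    · rw [Walk.support_concat, List.mem_append, List.mem_singleton] at hv
      rcases hv with hv | rfl
      · exact (hps v hv).tail hyz
      · exact .refl

theorem isTree_graph (h : IsNCArborescence n D) : h.graph.IsTree := by
  have hconn : h.graph.Connected := by
    rw [connected_iff_exists_forall_reachable]
    exact ⟨0, fun w => ⟨(h.exists_isPath w).choose⟩⟩
  rw [isTree_iff_connected_and_card]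
  refine ⟨hconn, le_antisymm ?_ hconn.card_vert_le_card_edgeSet_add_one⟩
  -- Sending each non-root vertex to its parent edge is onto the edges, so there are at most `n` of
  -- them; a connected graph with so few edges is a tree.
  have hpar : ∀ i : Fin n, ∃ v : Fin (n + 1), D v i.succ := fun i => by
    rcases (h.reach (x := (i.succ : Fin (n + 1))) (by omega) (by omega)).cases_tail with
      h0 | ⟨y, -, hy⟩
    · simp at h0
      omega
    · have hs := h.supp hy
      lift y to ℕ using hs.1
      exact ⟨⟨y, by omega⟩, hy⟩
  choose par hpar using hpar
  have hsurj : Function.Surjective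
      (fun i : Fin n => (⟨s(par i, i.succ), .inl (hpar i)⟩ : h.graph.edgeSet)) := by
    have key : ∀ {v w : Fin (n + 1)}, D v w → ∃ i : Fin n, s(par i, i.succ) = s(v, w) := by
      intro v w hvw
      obtain ⟨i, rfl⟩ : ∃ i : Fin n, i.succ = w := Fin.exists_succ_eq.2 (by
        rintro rfl
        have := h.supp hvw
        simp at this)
      refine ⟨i, ?_⟩
      rw [show par i = v from Fin.ext (by exact_mod_cast h.parent (hpar i) hvw)]
    rintro ⟨e, he⟩
    induction e using Sym2.ind with
    | _ v w =>
      rcases he with he | he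
      · obtain ⟨i, hi⟩ := key he
        exact ⟨i, Subtype.ext hi⟩
      · obtain ⟨i, hi⟩ := key he
        exact ⟨i, Subtype.ext (hi.trans Sym2.eq_swap)⟩
  have := Nat.card_le_card_of_surjective _ hsurj
  simpa using this

/-- The tree with a given parent-child relation and given labels. -/
def toGNCTree {f : ℤ → ℤ} (h : IsNCArborescence n D) (hf : IsSlowLabelling n f) :
    GNCTree n where
  graph := h.graph
  label v := (f v).toNat + 1
  isTree := h.isTree_graph
  noncrossing a b c d hab hbc hcd hadj :=
    h.noncrossing (a := a) (b := b) (c := c) (d := d) (by exact_mod_cast hab)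
      (by exact_mod_cast hbc) (by exact_mod_cast hcd) hadj.1 hadj.2
  label_mono v w hvw := by
    have := hf.mono (x := v) (y := w) (by omega) (by exact_mod_cast hvw) (by omega)
    simp only
    omega
  label_pos v := by omega
  label_full v i hi hi' := by
    have := hf.nonneg (x := v) (by omega) (by omega)
    obtain ⟨y, h1, h2, h3⟩ := hf.exists_eq (x := v) (i := i - 1) (by omega) (by omega)
      (by omega) (by omega)
    lift y to ℕ using h1
    refine ⟨⟨y, by omega⟩, ?_⟩
    simp only [h3]
    omega

theorem isEdge_toGNCTree {f : ℤ → ℤ} (h : IsNCArborescence n D) (hf : IsSlowLabelling n f)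
    {v w : Fin (n + 1)} : (h.toGNCTree hf).IsEdge v w ↔ D v w := by
  have key : ∀ {v w : Fin (n + 1)}, D v w → (h.toGNCTree hf).IsEdge v w := by
    intro v w hvw
    obtain ⟨p, hp, hps⟩ := h.exists_isPath v
    have hadj : h.graph.Adj v w := .inl hvw
    have hv : v ∈ (p.concat hadj).support := by simp [Walk.support_concat]
    exact ⟨hadj, p.concat hadj,
      hp.concat (fun hw => h.not_transGen_self w (.tail' (hps w hw) hvw)) hadj, hv⟩
  refine ⟨fun hvw => ?_, key⟩
  rcases hvw.1 with hD | hD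
  · exact hD
  · exact (hvw.asymm (key hD)).elim

end IsNCArborescence

/-! ### The bijection and the translation of patterns -/

namespace GNCTree

variable {n : ℕ} {T : GNCTree n} {t : ButterflyTree}

/-- `t` describes the edges and the labels of `T`. -/
structure IsDescribedBy (T : GNCTree n) (t : ButterflyTree) : Prop where
  size_eq : t.size = n
  isEdge_iff : ∀ v w : Fin (n + 1), T.IsEdge v w ↔ t.edges v w
  label_eq : ∀ v : Fin (n + 1), (T.label v : ℤ) = t.labels v + 1

theorem exists_isDescribedBy (T : GNCTree n) : ∃ t, T.IsDescribedBy t := by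
  obtain ⟨t, h1, h2, h3⟩ :=
    ButterflyTree.exists_edges_eq n T.isNCArborescence T.isSlowLabelling
  refine ⟨t, h1, fun v w => ?_, fun v => ?_⟩
  · rw [h2, T.edgeRel_coe]
  · rw [h3 v (by omega) (by omega), T.labelFun_coe]
    ring

theorem _root_.ButterflyTree.exists_isDescribedBy (t : ButterflyTree) (ht : t.size = n) :
    ∃ T : GNCTree n, T.IsDescribedBy t := by
  subst ht
  refine ⟨t.isNCArborescence.toGNCTree t.isSlowLabelling, rfl,
    fun v w => t.isNCArborescence.isEdge_toGNCTree _, fun v => ?_⟩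
  have := t.isSlowLabelling.nonneg (x := v) (by omega) (by omega)
  simp only [IsNCArborescence.toGNCTree]
  omega

theorem IsDescribedBy.left_unique {S : GNCTree n} (hS : S.IsDescribedBy t)
    (hT : T.IsDescribedBy t) : S = T := by
  refine GNCTree.ext ?_ ?_
  · ext v w
    rw [adj_iff, adj_iff, hS.isEdge_iff, hS.isEdge_iff, hT.isEdge_iff, hT.isEdge_iff]
  · funext v
    have := hS.label_eq v
    have := hT.label_eq v
    omega

theorem IsDescribedBy.edges_iff (h : T.IsDescribedBy t) {x y : ℤ} :
    t.edges x y ↔ ∃ v w : Fin (n + 1), T.IsEdge v w ∧ (v : ℤ) = x ∧ (w : ℤ) = y := by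
  obtain ⟨hs, he, -⟩ := h
  subst hs
  constructor
  · intro hxy
    have := t.isNCArborescence.supp hxy
    lift x to ℕ using by omega
    lift y to ℕ using by omega
    exact ⟨⟨x, by omega⟩, ⟨y, by omega⟩, (he _ _).2 hxy, rfl, rfl⟩
  · rintro ⟨v, w, hvw, rfl, rfl⟩
    exact (he v w).1 hvw

theorem IsDescribedBy.right_unique {s : ButterflyTree} (hs : T.IsDescribedBy s)
    (ht : T.IsDescribedBy t) : s = t := by
  refine ButterflyTree.eq_of_edges_eq (hs.size_eq.trans ht.size_eq.symm) ?_ fun x hx hx' => ?_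
  · ext x y
    rw [hs.edges_iff, ht.edges_iff]
  · rw [hs.size_eq] at hx'
    lift x to ℕ using hx
    have h1 := hs.label_eq ⟨x, by omega⟩
    have h2 := ht.label_eq ⟨x, by omega⟩
    simp only at h1 h2
    omega

-- `IsDescribedBy` is the graph of a bijection between GNC-trees and ternary trees of size `n`, so
-- corresponding properties have equal counts.
open Classical in
theorem card_filter_eq {P : GNCTree n → Prop} [DecidablePred P] {Q : ButterflyTree → Prop}
    (h : ∀ T t, T.IsDescribedBy t → (P T ↔ Q t)) :
    (Finset.univ.filter P).card = ((ButterflyTree.ofSize n).filter Q).card := by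
  choose g hg using exists_isDescribedBy (n := n)
  refine Finset.card_bij (fun T _ => g T) (fun T hT => ?_) (fun S _ T _ hST => ?_)
    fun t ht => ?_
  · rw [Finset.mem_filter] at hT ⊢
    exact ⟨ButterflyTree.mem_ofSize.2 (hg T).size_eq, (h T _ (hg T)).1 hT.2⟩
  · exact (hg S).left_unique (hST ▸ hg T)
  · rw [Finset.mem_filter, ButterflyTree.mem_ofSize] at ht
    obtain ⟨T, hT⟩ := t.exists_isDescribedBy ht.1
    exact ⟨T, Finset.mem_filter.2 ⟨Finset.mem_univ _, (h T t hT).2 ht.2⟩,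
      (hg T).right_unique hT⟩

theorem step_eq_u {v w : Fin (n + 1)} : T.step v w = .u ↔ T.label v < T.label w := by
  unfold step
  split_ifs <;> simp [*]

theorem step_eq_d {v w : Fin (n + 1)} : T.step v w = .d ↔ T.label w < T.label v := by
  unfold step
  split_ifs <;> simp <;> omega

theorem IsDescribedBy.label_lt_iff (h : T.IsDescribedBy t) {v w : Fin (n + 1)} :
    T.label v < T.label w ↔ t.labels v < t.labels w := by
  have := h.label_eq v
  have := h.label_eq w
  omega

theorem IsDescribedBy.avoids_ud (h : T.IsDescribedBy t) :
    T.Avoids [.u, .d] ↔ t.AvoidsAscentDescent := by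
  rw [← not_iff_not]
  simp only [Avoids, ButterflyTree.AvoidsAscentDescent, not_forall, not_not, Reads, step_eq_u,
    step_eq_d, h.label_lt_iff, and_true]
  constructor
  · rintro ⟨u, v, huv, hlt, w, hvw, hlt'⟩
    exact ⟨u, v, w, (h.isEdge_iff u v).1 huv, (h.isEdge_iff v w).1 hvw, hlt, hlt'⟩
  · rintro ⟨x, y, z, hxy, hyz, hlt, hlt'⟩
    obtain ⟨u, v, huv, rfl, rfl⟩ := h.edges_iff.1 hxy
    obtain ⟨v', w, hvw, hv, rfl⟩ := h.edges_iff.1 hyz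
    obtain rfl : v' = v := Fin.ext (by exact_mod_cast hv)
    exact ⟨u, v', huv, hlt, w, hvw, hlt'⟩

theorem IsDescribedBy.avoids_du (h : T.IsDescribedBy t) :
    T.Avoids [.d, .u] ↔ t.AvoidsDescentAscent := by
  rw [← not_iff_not]
  simp only [Avoids, ButterflyTree.AvoidsDescentAscent, not_forall, not_not, Reads, step_eq_u,
    step_eq_d, h.label_lt_iff, and_true]
  constructor
  · rintro ⟨u, v, huv, hlt, w, hvw, hlt'⟩
    exact ⟨u, v, w, (h.isEdge_iff u v).1 huv, (h.isEdge_iff v w).1 hvw, hlt, hlt'⟩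
  · rintro ⟨x, y, z, hxy, hyz, hlt, hlt'⟩
    obtain ⟨u, v, huv, rfl, rfl⟩ := h.edges_iff.1 hxy
    obtain ⟨v', w, hvw, hv, rfl⟩ := h.edges_iff.1 hyz
    obtain rfl : v' = v := Fin.ext (by exact_mod_cast hv)
    exact ⟨u, v', huv, hlt, w, hvw, hlt'⟩

theorem numSteps_eq_zero {s : GNCStep} :
    T.numSteps s = 0 ↔ ∀ v w, T.IsEdge v w → T.step v w ≠ s := by
  simp [numSteps, Finset.filter_eq_empty_iff]

theorem IsDescribedBy.flat_iff (h : T.IsDescribedBy t) :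
    T.numSteps .u = 0 ∧ T.numSteps .d = 0 ↔ t.Flat := by
  simp only [numSteps_eq_zero, ne_eq, step_eq_u, step_eq_d, h.label_lt_iff]
  constructor
  · rintro ⟨hu, hd⟩ x hx hx'
    have hr := t.isNCArborescence.reach hx hx'
    clear hx hx'
    -- Every edge is level, so the label `0` of the root propagates along the path to each point.
    induction hr with
    | refl => exact t.isSlowLabelling.zero
    | tail _ hyz ih =>
      obtain ⟨v, w, hvw, rfl, rfl⟩ := h.edges_iff.1 hyz
      have := hu v w hvw
      have := hd v w hvw
      omega
  · intro hf
    have key : ∀ {v w}, T.IsEdge v w → t.labels v = t.labels w := fun hvw =>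
      hf.labels_eq ((h.isEdge_iff _ _).1 hvw)
    exact ⟨fun v w hvw => (key hvw).not_lt, fun v w hvw => (key hvw).not_gt⟩

end GNCTree

/-! ### The series identities and uniqueness -/

open Classical in
theorem gncTAvoid_eq_genFun (R : Type*) [CommRing R] {σ : List GNCStep} {Q : ButterflyTree → Prop}
    (h : ∀ {n} {T : GNCTree n} {t}, T.IsDescribedBy t → (T.Avoids σ ↔ Q t)) :
    (gncTAvoid σ 1 1 1 : PowerSeries R) = ButterflyTree.genFun R Q := by
  ext n
  simp only [gncTAvoid, gncGenFun, ButterflyTree.genFun, PowerSeries.coeff_mk, one_pow, mul_one,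
    Finset.sum_const, nsmul_eq_mul]
  rw [GNCTree.card_filter_eq fun T t hT => by simpa using h hT]

-- Since `0 ^ 0 = 1`, the weight keeps exactly the trees without ascents and descents, that is,
-- those with constant labels.
open Classical in
theorem gncT_zero_one_zero (R : Type*) [CommRing R] :
    (gncT 0 1 0 : PowerSeries R) = ButterflyTree.genFun R ButterflyTree.Flat := by
  ext n
  have hterm : ∀ T : GNCTree n, (0 : R) ^ T.numSteps .u * 1 ^ T.numSteps .h * 0 ^ T.numSteps .d =
      if T.numSteps .u = 0 ∧ T.numSteps .d = 0 then 1 else 0 := fun T => by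
    by_cases hu : T.numSteps .u = 0 <;> by_cases hd : T.numSteps .d = 0 <;> simp [hu, hd]
  simp only [gncT, gncGenFun, ButterflyTree.genFun, PowerSeries.coeff_mk, hterm, Finset.sum_boole,
    Finset.filter_filter]
  rw [GNCTree.card_filter_eq fun T t hT => by simpa using hT.flat_iff]

-- Subtracting the equations writes both differences as `X` times combinations of these differences,
-- so divisibility by `X ^ n` improves to `X ^ (n + 1)`.
open PowerSeries in
theorem powerSeries_system_unique {R : Type*} [CommRing R] {K A B A' B' : PowerSeries R}
    (hA : A = 1 + 2 * X * A ^ 2 * (1 + X * K * B)) (hB : B = 1 + 2 * X * B ^ 2 * A)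
    (hA' : A' = 1 + 2 * X * A' ^ 2 * (1 + X * K * B')) (hB' : B' = 1 + 2 * X * B' ^ 2 * A') :
    A = A' ∧ B = B' := by
  have key : ∀ n, X ^ n ∣ A - A' ∧ X ^ n ∣ B - B' := by
    intro n
    induction n with
    | zero => simp
    | succ n ih =>
      obtain ⟨⟨c, hc⟩, ⟨d, hd⟩⟩ := ih
      constructor
      · refine ⟨2 * (c * (A + A') * (1 + X * K * B) + A' ^ 2 * X * K * d), ?_⟩
        calc A - A' = X * (2 * ((A - A') * (A + A') * (1 + X * K * B) +
              A' ^ 2 * X * K * (B - B'))) := by linear_combination hA - hA'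
          _ = _ := by rw [hc, hd]; ring
      · refine ⟨2 * (d * (B + B') * A + B' ^ 2 * c), ?_⟩
        calc B - B' = X * (2 * ((B - B') * (B + B') * A + B' ^ 2 * (A - A'))) := by
              linear_combination hB - hB'
          _ = _ := by rw [hc, hd]; ring
  constructor <;> ext n <;> rw [← sub_eq_zero, ← map_sub]
  · exact X_pow_dvd_iff.1 (key (n + 1)).1 n n.lt_succ_self
  · exact X_pow_dvd_iff.1 (key (n + 1)).2 n n.lt_succ_self

theorem mainTheorem11 (R : Type*) [CommRing R] :
    ((gncTAvoid [.u, .d] 1 1 1 : PowerSeries R) =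
        1 + 2 * PowerSeries.X * gncTAvoid [.u, .d] 1 1 1 ^ 2 *
          (1 + PowerSeries.X * gncT 0 1 0 ^ 2 * gncTAvoid [.d, .u] 1 1 1) ∧
      (gncTAvoid [.d, .u] 1 1 1 : PowerSeries R) =
        1 + 2 * PowerSeries.X * gncTAvoid [.d, .u] 1 1 1 ^ 2 * gncTAvoid [.u, .d] 1 1 1) ∧
    ∀ A B : PowerSeries R,
      A = 1 + 2 * PowerSeries.X * A ^ 2 * (1 + PowerSeries.X * gncT 0 1 0 ^ 2 * B) →
      B = 1 + 2 * PowerSeries.X * B ^ 2 * A →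
        A = gncTAvoid [.u, .d] 1 1 1 ∧ B = gncTAvoid [.d, .u] 1 1 1 := by
  rw [gncTAvoid_eq_genFun R GNCTree.IsDescribedBy.avoids_ud,
    gncTAvoid_eq_genFun R GNCTree.IsDescribedBy.avoids_du, gncT_zero_one_zero]
  exact ⟨⟨ButterflyTree.genFun_avoidsAscentDescent R, ButterflyTree.genFun_avoidsDescentAscent R⟩,
    fun A B hA hB => powerSeries_system_unique hA hB (ButterflyTree.genFun_avoidsAscentDescent R)
      (ButterflyTree.genFun_avoidsDescentAscent R)⟩
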